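/- Let $c>0$ and let $\lambda:(0,\infty)\to[0,\infty)$ be continuously differentiable. Let $N$ be a Poisson process on $(0,\infty)$ with rate function $\lambda$; write $N(s,t]$ for the number of its events in $(s,t]$ (if $\lambda$ is not integrable at $0$, infinitely many events accumulate at time $0$). Let $\{V(t)\}_{t\ge0}$ be a process with values in $\{c,0,-c\}$ such that: * $P\{V(0)=c\}=P\{V(0)=-c\}=\tfrac14$, $P\{V(0)=0\}=\tfrac12$, and for all $0\le s\le t$ the number $N(s,t]$ is independent of the past up to time $s$, i.e. of $V(u)$, $0\le u\le s$, and $N(a,b]$, $0\le a\le b\le s$ (in particular $V(0)$ is independent of $N$); * $V$ changes only at events of $N$; given the past up to time $s$ and that $N(s,t]=1$, if $V(s)=\pm c$ then $V(t)=0$, and if $V(s)=0$ then $V(t)=c$ or $V(t)=-c$ with probability $\tfrac12$ each. Let $\mathcal T(t)=\int_0^tV(s)\,ds$, $\mu_t$ the law of $\mathcal T(t)$ and $\Lambda(t)=\int_0^t\lambda(s)\,ds\in[0,\infty]$. Then: 1. (Density.) There is a function $p(x,t)\ge0$ such that, for every $t>0$, $$\mu_t(dx)=p(x,t)\,dx+\sum_{y\in\{0,ct,-ct\}}P\{\mathcal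 T(t)=y\}\,\delta_y(dx).$$ 2. (Equation.) The law of $\mathcal T(t)$ satisfies $$\frac{\partial^3p}{\partial t^3}+3\lambda(t)\frac{\partial^2p}{\partial t^2}+\bigl(2\lambda(t)^2+\lambda'(t)\bigr)\frac{\partial p}{\partial t}=c^2\frac{\partial^3p}{\partial t\,\partial x^2}+c^2\lambda(t)\frac{\partial^2p}{\partial x^2}\qquad(\ast)$$ on $\mathbb R\times(0,\infty)$ in the following sense: for every $\psi\in C_c^\infty(\mathbb R)$ the function $m_\psi(t)=\int\psi\,d\mu_t$ is $C^3$ on $(0,\infty)$ and $$m_\psi'''+3\lambda m_\psi''+(2\lambda^2+\lambda')m_\psi'=c^2m_{\psi''}'+c^2\lambda\,m_{\psi''}.$$ Moreover, let $p$ be any density as in 1 and let $W\subset\mathbb R\times(0,\infty)$ be an open set with $P\{\mathcal T(t)=x\}=0$ for all $(x,t)\in W$. Then $p$ satisfies $(\ast)$ on $W$ in the same sense (for all $\psi$ and $t$ with $\operatorname{supp}\psi\times\{t\}\subset W$), and if $p$ is of class $C^3$ on $W$, then $(\ast)$ holds at every point of $W$. 3. (Atoms.) For every $t>0$ with $\Lambda(t)<\infty$,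 $$P\{\mathcal T(t)=ct\}=P\{\mathcal T(t)=-ct\}=\tfrac12P\{\mathcal T(t)=0\}=\tfrac14e^{-\Lambda(t)},$$ and for every $t>0$ with $\Lambda(t)=\infty$ the law of $\mathcal T(t)$ has no atoms, so that $p(\cdot,t)$ is its density. -/

import Mathlib

open MeasureTheory ProbabilityTheory Set

noncomputable section

/-- Number of events in the time interval `(s, t]`, for a random set of event times `E`.
For `s = 0` this is the usual counting process `N(t)`; it may be infinite when the rate is not
integrable at `0`. -/
def eventCount {Ω : Type*} (E : Ω → Set ℝ) (s t : ℝ) (ω : Ω) : ℕ∞ :=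
  (E ω ∩ Ioc s t).encard

/-- The σ-algebra generated by the numbers of events in the intervals `(a, b]`,
`0 ≤ a ≤ b ≤ s`. -/
abbrev countHistory {Ω : Type*} (E : Ω → Set ℝ) (s : ℝ) : MeasurableSpace Ω :=
  ⨆ (a : ℝ) (b : ℝ) (_ : 0 ≤ a ∧ a ≤ b ∧ b ≤ s),
    MeasurableSpace.comap (eventCount E a b) ⊤

/-- The σ-algebra of the past up to time `s`: generated by the velocities `V u`, `0 ≤ u ≤ s`, and
by the numbers of events in the intervals `(a, b]`, `0 ≤ a ≤ b ≤ s`. -/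
abbrev motionHistory {Ω : Type*} (E : Ω → Set ℝ) (V : ℝ → Ω → ℝ) (s : ℝ) : MeasurableSpace Ω :=
  (⨆ (u : ℝ) (_ : 0 ≤ u ∧ u ≤ s), MeasurableSpace.comap (V u) inferInstance) ⊔ countHistory E s

/-- `E` is the set of event times of a (non-homogeneous) Poisson process on `(0, ∞)` with rate
function `rate`. The rate need not be integrable at `0`; then infinitely many events
accumulate at time `0`. -/
structure IsPoissonProcess {Ω : Type*} [MeasurableSpace Ω] (P : Measure Ω) (rate : ℝ → ℝ)
    (E : Ω → Set ℝ) : Prop where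
  finite_events : ∀ ω : Ω, ∀ a b : ℝ, 0 < a → (E ω ∩ Icc a b).Finite
  measurable_count : ∀ s t : ℝ, 0 ≤ s → s ≤ t → ∀ k : ℕ∞,
    MeasurableSet {ω | eventCount E s t ω = k}
  poisson_law : ∀ s t : ℝ, 0 ≤ s → s ≤ t → IntegrableOn rate (Ioc s t) → ∀ k : ℕ,
    P.real {ω | eventCount E s t ω = k} =
      Real.exp (-∫ u in Ioc s t, rate u) * (∫ u in Ioc s t, rate u) ^ k / (Nat.factorial k : ℝ)
  indep_increments : ∀ s t : ℝ, 0 ≤ s → s ≤ t →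
    Indep (MeasurableSpace.comap (eventCount E s t) ⊤) (countHistory E s) P

/-- `V` is a velocity process with values in `{c, 0, -c}` that switches exactly at the events of
the Poisson process `E` of rate `rate`: at an event, velocities `±c` become `0`, and velocity `0`
becomes `c` or `-c` with probability `1/2` each, independently of the past.
The initial velocity is `c, 0, -c` with probabilities `1/4, 1/2, 1/4`; its independence from the
Poisson process is contained in `indep_future`. -/
structure IsStopMotionVelocity {Ω : Type*} [MeasurableSpace Ω] (P : Measure Ω) (c : ℝ)
    (rate : ℝ → ℝ) (E : Ω → Set ℝ) (V : ℝ → Ω → ℝ) : Prop where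
  poisson : IsPoissonProcess P rate E
  measurable_velocity : ∀ t : ℝ, 0 ≤ t → Measurable (V t)
  velocity_mem : ∀ t : ℝ, 0 ≤ t → ∀ ω : Ω, V t ω = c ∨ V t ω = 0 ∨ V t ω = -c
  init_pos : P.real {ω | V 0 ω = c} = 1 / 4
  init_zero : P.real {ω | V 0 ω = 0} = 1 / 2
  init_neg : P.real {ω | V 0 ω = -c} = 1 / 4
  /-- The events after time `s` are independent of the past up to time `s`. -/
  indep_future : ∀ s t : ℝ, 0 ≤ s → s ≤ t →
    Indep (MeasurableSpace.comap (eventCount E s t) ⊤) (motionHistory E V s) P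
  /-- Without an event in `(s, t]` the velocity does not change. -/
  const_between : ∀ s t : ℝ, 0 ≤ s → s ≤ t → ∀ ω : Ω, eventCount E s t ω = 0 → V t ω = V s ω
  /-- Exactly one event in `(s, t]`, velocity `0` at time `s`: velocity `c` with
  probability `1/2`, given the past. -/
  switch_pos : ∀ s t : ℝ, 0 ≤ s → s ≤ t → ∀ A : Set Ω, MeasurableSet[motionHistory E V s] A →
    P.real (A ∩ {ω | V s ω = 0 ∧ eventCount E s t ω = 1 ∧ V t ω = c}) =
      1 / 2 * P.real (A ∩ {ω | V s ω = 0 ∧ eventCount E s t ω = 1})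
  /-- Exactly one event in `(s, t]`, velocity `0` at time `s`: velocity `-c` with
  probability `1/2`, given the past. -/
  switch_neg : ∀ s t : ℝ, 0 ≤ s → s ≤ t → ∀ A : Set Ω, MeasurableSet[motionHistory E V s] A →
    P.real (A ∩ {ω | V s ω = 0 ∧ eventCount E s t ω = 1 ∧ V t ω = -c}) =
      1 / 2 * P.real (A ∩ {ω | V s ω = 0 ∧ eventCount E s t ω = 1})
  /-- Exactly one event in `(s, t]`, velocity `c` or `-c` at time `s`: velocity `0` almost
  surely. -/
  switch_stop : ∀ s t : ℝ, 0 ≤ s → s ≤ t →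
    P.real {ω | (V s ω = c ∨ V s ω = -c) ∧ eventCount E s t ω = 1 ∧ V t ω ≠ 0} = 0

/-- The position `∫₀ᵗ V(s) ds` of the particle at time `t`. -/
def position {Ω : Type*} (V : ℝ → Ω → ℝ) (t : ℝ) (ω : Ω) : ℝ :=
  ∫ s in (0 : ℝ)..t, V s ω

/-- `p(·, t)` is, for every `t > 0`, a density of the absolutely continuous component of the
law of `X t`, the rest of the law being carried by the three points `0`, `c t`, `-c t`. -/
structure IsTransitionDensity {Ω : Type*} [MeasurableSpace Ω] (P : Measure Ω) (c : ℝ)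
    (X : ℝ → Ω → ℝ) (p : ℝ → ℝ → ℝ) : Prop where
  measurable : ∀ t : ℝ, 0 < t → Measurable (fun x => p x t)
  nonneg : ∀ x t : ℝ, 0 < t → 0 ≤ p x t
  law_eq : ∀ t : ℝ, 0 < t →
    P.map (X t) =
      volume.withDensity (fun x => ENNReal.ofReal (p x t))
        + P {ω | X t ω = 0} • Measure.dirac (0 : ℝ)
        + P {ω | X t ω = c * t} • Measure.dirac (c * t)
        + P {ω | X t ω = -(c * t)} • Measure.dirac (-(c * t))

/-- The equation
`p_ttt + 3 λ p_tt + (2 λ² + λ') p_t = c² p_txx + c² λ p_xx` at the point `(x, t)`. -/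
def SatisfiesStopPDEAt (c : ℝ) (rate : ℝ → ℝ) (p : ℝ → ℝ → ℝ) (x t : ℝ) : Prop :=
  iteratedDeriv 3 (fun s => p x s) t
      + 3 * rate t * iteratedDeriv 2 (fun s => p x s) t
      + (2 * rate t ^ 2 + deriv rate t) * deriv (fun s => p x s) t =
    c ^ 2 * deriv (fun s => iteratedDeriv 2 (fun y => p y s) x) t
      + c ^ 2 * rate t * iteratedDeriv 2 (fun y => p y t) x

/-- The same equation for a family `μ t` of measures on the line, on a set `W` of points `(x, t)`,
in the sense of distributions in `x`: for every test function `ψ` and every `t > 0` such that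
`W` contains `supp ψ × {t}`, the function `s ↦ ∫ ψ dμ_s` is `C³` near `t`, and
`(d/dt)³⟨μ,ψ⟩ + 3 λ (d/dt)²⟨μ,ψ⟩ + (2 λ² + λ') (d/dt)⟨μ,ψ⟩ = c² (d/dt)⟨μ,ψ''⟩ + c² λ ⟨μ,ψ''⟩`
at time `t`. -/
def IsWeakStopPDESolutionOn (c : ℝ) (rate : ℝ → ℝ) (μ : ℝ → Measure ℝ) (W : Set (ℝ × ℝ)) :
    Prop :=
  ∀ ψ : ℝ → ℝ, ContDiff ℝ ((⊤ : ℕ∞) : WithTop ℕ∞) ψ → HasCompactSupport ψ → ∀ t : ℝ, 0 < t →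
    (∀ x ∈ tsupport ψ, (x, t) ∈ W) →
      ContDiffAt ℝ 3 (fun s => ∫ x, ψ x ∂(μ s)) t ∧
      iteratedDeriv 3 (fun s => ∫ x, ψ x ∂(μ s)) t
          + 3 * rate t * iteratedDeriv 2 (fun s => ∫ x, ψ x ∂(μ s)) t
          + (2 * rate t ^ 2 + deriv rate t) * deriv (fun s => ∫ x, ψ x ∂(μ s)) t =
        c ^ 2 * deriv (fun s => ∫ x, iteratedDeriv 2 ψ x ∂(μ s)) t
          + c ^ 2 * rate t * ∫ x, iteratedDeriv 2 ψ x ∂(μ t)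

end

/-! For a test function `f`, a frame velocity `a` and a velocity `w`, let `m_w[f](u)` be the mean of
`f (X u - a u)` over `V u = w`, where `X` is the position (`cellMean`). Splitting by the number of
events in a short interval gives, at every positive time, the forward equation `m_w[f]' = (w - a)
m_w[f'] + λ (r m_D[f] - m_w[f])`, where `D` is the set of velocities from which `w` is reached and
`r` the switching probability (`cellMean_hasDerivAt`). Nothing in it refers to time `0`, so a rate
that is not integrable there does no harm.

With `a = 0`, the three equations for `c`, `-c`, `0` applied to `ψ` and its derivatives form a
linear system. In the total mean the jump terms cancel; eliminating the mean over velocity `0`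
leaves the third-order equation (`stopMotion_thirdOrder`).

The density comes from the same equation in moving frames. In the frame `a = w` the transport term
vanishes: the mean is damped by `exp (-∫ λ)` and fed by the other velocities. Each jump changes the
velocity by `c`, so the feeding velocities move relative to this frame. Applying the forward
equation to a primitive of the test function then bounds the time integral of the inflow by the
Lebesgue integral of the test function (`abs_integral_cellMean_le`). Hence the law of `X t` is at
most `exp (-∫ λ)` over `(s, t]` times the law of `X s + (t - s) V s`, plus a multiple of Lebesgue
measure (`integral_test_le`), and the second part is invisible on null sets. Letting `s → 0`, null
sets have probability zero if the rate is not integrable at `0`; otherwise their probability is at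
most `exp (-Λ t)` times that of `t * V 0`, so singular mass can sit only at `0` and `±ct`. Paths
without events supply the matching lower bound for the atoms.

Away from atoms the density has the same integrals as the law against test functions, so it inherits
the weak equation. Where it is `C³`, integration by parts and the fundamental lemma of the calculus
of variations give the pointwise equation. -/

open Filter Topology

/-! ### Local finiteness of the events away from time 0. -/

section Events

variable {Ω : Type*} {E : Ω → Set ℝ} {ω : Ω}

theorem eventCount_eq_zero_mono {s t s' t' : ℝ} (hs : s ≤ s') (ht : t' ≤ t)
    (h : eventCount E s t ω = 0) : eventCount E s' t' ω = 0 := by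
  rw [eventCount, encard_eq_zero] at h ⊢
  exact subset_eq_empty (inter_subset_inter_right _ (Ioc_subset_Ioc hs ht)) h

variable [MeasurableSpace Ω] {P : Measure Ω} {rate : ℝ → ℝ}

/-- Finitely many events near `u` leave a gap around a time that is not an event. The bound `ε < u`
keeps the window inside positive times, where `const_between` can be applied. -/
theorem IsPoissonProcess.exists_eventCount_eq_zero (hE : IsPoissonProcess P rate E) {u : ℝ}
    (hu : 0 < u) (hne : u ∉ E ω) :
    ∃ ε > 0, ε < u ∧ eventCount E (u - ε) (u + ε) ω = 0 := by
  have hfin := hE.finite_events ω (u / 2) (u + 1) (by linarith)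
  have hnhds : (E ω ∩ Icc (u / 2) (u + 1))ᶜ ∈ 𝓝 u :=
    hfin.isClosed.isOpen_compl.mem_nhds fun h => hne h.1
  obtain ⟨δ, hδ, hball⟩ := Metric.mem_nhds_iff.1 hnhds
  refine ⟨min (δ / 2) (min (u / 2) 1), by positivity, ?_, ?_⟩
  · exact ((min_le_right _ _).trans (min_le_left _ _)).trans_lt (by linarith)
  · rw [eventCount, encard_eq_zero, eq_empty_iff_forall_notMem]
    rintro x ⟨hxE, hx1, hx2⟩
    have h1 : min (δ / 2) (min (u / 2) 1) ≤ δ / 2 := min_le_left _ _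
    have h2 : min (δ / 2) (min (u / 2) 1) ≤ u / 2 := (min_le_right _ _).trans (min_le_left _ _)
    have h3 : min (δ / 2) (min (u / 2) 1) ≤ 1 := (min_le_right _ _).trans (min_le_right _ _)
    have hmem : x ∈ Metric.ball u δ := by
      rw [Metric.mem_ball, Real.dist_eq, abs_lt]
      constructor <;> linarith
    exact hball hmem ⟨hxE, by linarith, by linarith⟩

theorem IsPoissonProcess.countable_events (hE : IsPoissonProcess P rate E) (ω : Ω) :
    (E ω ∩ Ioi 0).Countable := by
  refine (countable_iUnion fun n : ℕ =>
    (hE.finite_events ω (1 / ((n : ℝ) + 1)) n (by positivity)).countable).mono ?_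
  rintro x ⟨hx, hx0⟩
  obtain ⟨n, hn⟩ := exists_nat_gt (max x (1 / x))
  have hn1 := (le_max_left _ _).trans_lt hn
  have hn2 := (le_max_right _ _).trans_lt hn
  refine mem_iUnion.2 ⟨n, hx, ?_, hn1.le⟩
  rw [div_le_iff₀ (by positivity)]
  rw [div_lt_iff₀ hx0] at hn2
  have : 0 < x := hx0
  nlinarith

theorem IsPoissonProcess.ae_notMem_events (hE : IsPoissonProcess P rate E) (ω : Ω) :
    ∀ᵐ u : ℝ, 0 < u → u ∉ E ω := by
  filter_upwards [(hE.countable_events ω).ae_notMem volume] with u hu h0 hE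
  exact hu ⟨hE, h0⟩

theorem IsPoissonProcess.measurable_eventCount (hE : IsPoissonProcess P rate E) {s t : ℝ}
    (hs : 0 ≤ s) (hst : s ≤ t) : Measurable[_, ⊤] (eventCount E s t) :=
  @measurable_to_countable' _ _ ⊤ _ _ _ fun k => hE.measurable_count s t hs hst k

theorem IsPoissonProcess.countHistory_le (hE : IsPoissonProcess P rate E) (s : ℝ) :
    countHistory E s ≤ ‹MeasurableSpace Ω› :=
  iSup_le fun _ => iSup_le fun _ => iSup_le fun h =>
    (hE.measurable_eventCount h.1 h.2.1).comap_le

end Events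

/-- Integrals along the paths of a bounded process are measurable if almost every time is
a point of continuity from the left of each path. -/
theorem measurable_intervalIntegral_path {Ω : Type*} [MeasurableSpace Ω] {V : ℝ → Ω → ℝ}
    {t C : ℝ} (ht : 0 ≤ t) (hmeas : ∀ u, 0 ≤ u → u ≤ t → Measurable (V u))
    (hbound : ∀ u, 0 ≤ u → ∀ ω, |V u ω| ≤ C)
    (hcont : ∀ ω, ∀ᵐ u : ℝ, 0 < u → Tendsto (fun v => V v ω) (𝓝[≤] u) (𝓝 (V u ω))) :
    Measurable fun ω => ∫ u in (0 : ℝ)..t, V u ω := by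
  -- The path is sampled at the grid point just below `u`: only countably many times enter, so joint
  -- measurability is free, and left continuity suffices in the limit. The cap at `t` ensures that
  -- no velocity after time `t` is used, which later gives measurability with respect to the past.
  set τ : ℕ → ℕ → ℝ := fun n k => min ((k : ℝ) / (n + 1)) t with hτ
  have hτ0 : ∀ n k, 0 ≤ τ n k := fun n k => le_min (by positivity) ht
  have hjoint : ∀ n : ℕ, Measurable fun z : Ω × ℝ => V (τ n ⌊((n : ℝ) + 1) * z.2⌋₊) z.1 := by
    intro n
    have h1 : Measurable fun z : Ω × ℕ => V (τ n z.2) z.1 :=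
      measurable_from_prod_countable_left fun k => hmeas _ (hτ0 n k) (min_le_right _ _)
    have h2 : Measurable fun z : Ω × ℝ => (z.1, ⌊((n : ℝ) + 1) * z.2⌋₊) :=
      measurable_fst.prodMk (Nat.measurable_floor.comp (measurable_snd.const_mul _))
    exact h1.comp h2
  refine measurable_of_tendsto_metrizable
    (f := fun (n : ℕ) ω => ∫ u in (0 : ℝ)..t, V (τ n ⌊((n : ℝ) + 1) * u⌋₊) ω) (fun n => ?_) ?_
  · simp_rw [intervalIntegral.integral_of_le ht]
    exact (StronglyMeasurable.integral_prod_right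
      (f := fun ω (u : ℝ) => V (τ n ⌊((n : ℝ) + 1) * u⌋₊) ω) (hjoint n).stronglyMeasurable).measurable
  · rw [tendsto_pi_nhds]
    intro ω
    refine intervalIntegral.tendsto_integral_filter_of_dominated_convergence (fun _ => C) ?_ ?_
      intervalIntegrable_const ?_
    · exact .of_forall fun n => ((hjoint n).comp measurable_prodMk_left).aestronglyMeasurable
    · exact .of_forall fun n => .of_forall fun u _ => hbound _ (hτ0 _ _) ω
    · filter_upwards [hcont ω] with u hu hut
      rw [uIoc_of_le ht] at hut
      refine (hu hut.1).comp ?_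
      have hn : ∀ n : ℕ, τ n ⌊((n : ℝ) + 1) * u⌋₊ = (⌊((n : ℝ) + 1) * u⌋₊ : ℝ) / (n + 1) := by
        intro n
        refine min_eq_left (le_trans ?_ hut.2)
        rw [div_le_iff₀ (by positivity), mul_comm]
        exact Nat.floor_le (by have := hut.1; positivity)
      refine tendsto_nhdsWithin_iff.2 ⟨?_, .of_forall fun n => ?_⟩
      · simp_rw [hn]
        have h := (tendsto_nat_floor_mul_div_atTop hut.1.le).comp
          (tendsto_atTop_add_const_right atTop (1 : ℝ) (tendsto_natCast_atTop_atTop (R := ℝ)))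
        refine h.congr fun n => ?_
        simp [mul_comm]
      · rw [hn, mem_Iic, div_le_iff₀ (by positivity), mul_comm]
        exact Nat.floor_le (by have := hut.1; positivity)

theorem measurable_velocity_history {Ω : Type*} {E : Ω → Set ℝ} {V : ℝ → Ω → ℝ} {u s : ℝ}
    (hu : 0 ≤ u) (hus : u ≤ s) : Measurable[motionHistory E V s] (V u) :=
  measurable_iff_comap_le.2 <| le_sup_of_le_left <|
    le_iSup_of_le u <| le_iSup_of_le ⟨hu, hus⟩ le_rfl

/-! ### Path regularity and adaptedness of the position. -/

section Motion

variable {Ω : Type*} [MeasurableSpace Ω] {P : Measure Ω} {c : ℝ} {rate : ℝ → ℝ} {E : Ω → Set ℝ}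
  {V : ℝ → Ω → ℝ}

namespace IsStopMotionVelocity

theorem motionHistory_le (hV : IsStopMotionVelocity P c rate E V) (s : ℝ) :
    motionHistory E V s ≤ ‹MeasurableSpace Ω› :=
  sup_le (iSup_le fun u => iSup_le fun hu => (hV.measurable_velocity u hu.1).comap_le)
    (hV.poisson.countHistory_le s)

theorem abs_velocity_le (hV : IsStopMotionVelocity P c rate E V) (hc : 0 < c) {u : ℝ}
    (hu : 0 ≤ u) (ω : Ω) : |V u ω| ≤ c := by
  rcases hV.velocity_mem u hu ω with h | h | h <;> simp [h, abs_of_pos hc, hc.le]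

theorem velocity_eventuallyEq (hV : IsStopMotionVelocity P c rate E V) {u : ℝ} (hu : 0 < u)
    {ω : Ω} (hne : u ∉ E ω) : ∀ᶠ v in 𝓝 u, V v ω = V u ω := by
  obtain ⟨ε, hε, hεu, h0⟩ := hV.poisson.exists_eventCount_eq_zero hu hne
  filter_upwards [Icc_mem_nhds (show u - ε < u by linarith) (show u < u + ε by linarith)] with v hv
  rw [hV.const_between (u - ε) v (by linarith) hv.1 ω (eventCount_eq_zero_mono le_rfl hv.2 h0),
    hV.const_between (u - ε) u (by linarith) (by linarith) ω
      (eventCount_eq_zero_mono le_rfl (by linarith) h0)]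

/-- Off the countable set of events the path is locally constant, hence continuous; the events form
a null set and the velocity is bounded. -/
theorem intervalIntegrable_velocity (hV : IsStopMotionVelocity P c rate E V) (hc : 0 < c)
    {s t : ℝ} (hs : 0 ≤ s) (ht : 0 ≤ t) (ω : Ω) :
    IntervalIntegrable (fun u => V u ω) volume s t := by
  have hcount := hV.poisson.countable_events ω
  have hm : AEStronglyMeasurable (fun u => V u ω) (volume.restrict (Ioi 0)) := by
    have hcont : ContinuousOn (fun u => V u ω) (Ioi 0 \ (E ω ∩ Ioi 0)) := fun u hu =>
      ((continuousAt_const (y := V u ω)).congr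
        ((hV.velocity_eventuallyEq hu.1 fun h => hu.2 ⟨h, hu.1⟩).mono
          fun _ h => h.symm)).continuousWithinAt
    have h := hcont.aestronglyMeasurable (μ := volume)
      (measurableSet_Ioi.diff hcount.measurableSet)
    rwa [Measure.restrict_congr_set (sdiff_null_ae_eq_self (hcount.measure_zero _))] at h
  have hsub : uIoc s t ⊆ Ioi 0 := fun x hx => lt_of_le_of_lt (le_min hs ht) hx.1
  rw [intervalIntegrable_iff]
  have : IsFiniteMeasure (volume.restrict (uIoc s t)) := ⟨by simp [uIoc]⟩
  refine Integrable.of_bound (hm.mono_set hsub) c ?_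
  filter_upwards [ae_restrict_mem measurableSet_uIoc] with u hu
  exact hV.abs_velocity_le hc (hsub hu).le ω

/-- Adaptedness is what allows functions of `position V s` to be averaged against the events after
`s` through `indep_future` and the switching rules. -/
theorem measurable_position_history (hV : IsStopMotionVelocity P c rate E V) (hc : 0 < c) {t : ℝ}
    (ht : 0 ≤ t) : Measurable[motionHistory E V t] (position V t) := by
  refine @measurable_intervalIntegral_path Ω (motionHistory E V t) V t c ht
    (fun u hu hut => measurable_velocity_history hu hut)
    (fun u hu ω => hV.abs_velocity_le hc hu ω) fun ω => ?_
  filter_upwards [hV.poisson.ae_notMem_events ω] with u hu h0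
  exact (tendsto_const_nhds.congr' ((hV.velocity_eventuallyEq h0 (hu h0)).mono
    fun _ h => h.symm)).mono_left nhdsWithin_le_nhds

theorem measurable_position (hV : IsStopMotionVelocity P c rate E V) (hc : 0 < c) {t : ℝ}
    (ht : 0 ≤ t) : Measurable (position V t) :=
  (hV.measurable_position_history hc ht).mono (hV.motionHistory_le t) le_rfl

theorem position_sub (hV : IsStopMotionVelocity P c rate E V) (hc : 0 < c) {s t : ℝ}
    (hs : 0 ≤ s) (ht : 0 ≤ t) (ω : Ω) :
    position V t ω - position V s ω = ∫ u in s..t, V u ω :=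
  intervalIntegral.integral_interval_sub_left
    (hV.intervalIntegrable_velocity hc le_rfl ht ω)
    (hV.intervalIntegrable_velocity hc le_rfl hs ω)

theorem abs_position_sub_le (hV : IsStopMotionVelocity P c rate E V) (hc : 0 < c) {s t : ℝ}
    (hs : 0 ≤ s) (ht : 0 ≤ t) (ω : Ω) :
    |position V t ω - position V s ω| ≤ c * |t - s| := by
  rw [hV.position_sub hc hs ht, ← Real.norm_eq_abs]
  exact intervalIntegral.norm_integral_le_of_norm_le_const fun u hu =>
    hV.abs_velocity_le hc ((le_min hs ht).trans hu.1.le) ω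

theorem position_eq_of_eventCount_eq_zero (hV : IsStopMotionVelocity P c rate E V) (hc : 0 < c)
    {s t : ℝ} (hs : 0 ≤ s) (hst : s ≤ t) {ω : Ω} (h0 : eventCount E s t ω = 0) :
    position V t ω = position V s ω + (t - s) * V s ω := by
  rw [← sub_eq_iff_eq_add', hV.position_sub hc hs (hs.trans hst)]
  rw [intervalIntegral.integral_congr (g := fun _ => V s ω)]
  · simp
  · intro u hu
    rw [uIcc_of_le hst] at hu
    exact hV.const_between s u hs hu.1 ω (eventCount_eq_zero_mono le_rfl hu.2 h0)

end IsStopMotionVelocity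

end Motion

/-- The hypothesis says that two measures coincide on the smaller σ-algebra, so they integrate its
measurable functions equally. This turns both independence (`B₂ = univ`) and the switching rules
into identities between integrals. -/
theorem setIntegral_eq_mul_of_forall_measureReal {Ω : Type*} {m₀ m : MeasurableSpace Ω}
    {P : Measure Ω} [IsFiniteMeasure P] (hm : m₀ ≤ m) {B₁ B₂ : Set Ω}
    {r : ℝ} (hr : 0 ≤ r)
    (h : ∀ A, MeasurableSet[m₀] A → P.real (A ∩ B₁) = r * P.real (A ∩ B₂)) {F : Ω → ℝ}
    (hF : StronglyMeasurable[m₀] F) :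
    ∫ ω in B₁, F ω ∂P = r * ∫ ω in B₂, F ω ∂P := by
  have htrim : (P.restrict B₁).trim hm = (ENNReal.ofReal r • P.restrict B₂).trim hm := by
    refine @Measure.ext _ m₀ _ _ fun A hA => ?_
    rw [trim_measurableSet_eq hm hA, trim_measurableSet_eq hm hA, Measure.smul_apply,
      Measure.restrict_apply (hm A hA), Measure.restrict_apply (hm A hA), smul_eq_mul,
      ← ENNReal.toReal_eq_toReal_iff' (measure_ne_top _ _)
        (ENNReal.mul_ne_top ENNReal.ofReal_ne_top (measure_ne_top _ _)),
      ENNReal.toReal_mul, ENNReal.toReal_ofReal hr]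
    exact h A hA
  rw [integral_trim hm hF, htrim, ← integral_trim hm hF, integral_smul_measure,
    ENNReal.toReal_ofReal hr, smul_eq_mul]

/-! ### Probabilities of zero, one and more events in a short interval. -/

section Poisson

variable {Ω : Type*} [MeasurableSpace Ω] {P : Measure Ω} {rate : ℝ → ℝ} {E : Ω → Set ℝ}

theorem intervalIntegrable_rate (hrate : ContinuousOn rate (Ioi 0)) {s t : ℝ} (hs : 0 < s)
    (ht : 0 < t) : IntervalIntegrable rate volume s t :=
  (hrate.mono fun _ hx => (lt_min hs ht).trans_le hx.1).intervalIntegrable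

theorem integral_rate_nonneg (hnonneg : ∀ t, 0 < t → 0 ≤ rate t) {s t : ℝ} (hs : 0 < s)
    (hst : s ≤ t) : 0 ≤ ∫ u in s..t, rate u :=
  intervalIntegral.integral_nonneg hst fun u hu => hnonneg u (hs.trans_le hu.1)

namespace IsPoissonProcess

theorem measureReal_eventCount_eq (hE : IsPoissonProcess P rate E)
    (hrate : ContinuousOn rate (Ioi 0)) {s t : ℝ} (hs : 0 < s) (hst : s ≤ t) (k : ℕ) :
    P.real {ω | eventCount E s t ω = k} =
      Real.exp (-∫ u in s..t, rate u) * (∫ u in s..t, rate u) ^ k / (Nat.factorial k : ℝ) := by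
  rw [intervalIntegral.integral_of_le hst]
  exact hE.poisson_law s t hs.le hst (intervalIntegrable_rate hrate hs (hs.trans_le hst)).1 k

theorem measureReal_eventCount_eq_zero (hE : IsPoissonProcess P rate E)
    (hrate : ContinuousOn rate (Ioi 0)) {s t : ℝ} (hs : 0 < s) (hst : s ≤ t) :
    P.real {ω | eventCount E s t ω = 0} = Real.exp (-∫ u in s..t, rate u) := by
  simpa using hE.measureReal_eventCount_eq hrate hs hst 0

theorem measureReal_eventCount_eq_one (hE : IsPoissonProcess P rate E)
    (hrate : ContinuousOn rate (Ioi 0)) {s t : ℝ} (hs : 0 < s) (hst : s ≤ t) :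
    P.real {ω | eventCount E s t ω = 1} =
      Real.exp (-∫ u in s..t, rate u) * ∫ u in s..t, rate u := by
  simpa using hE.measureReal_eventCount_eq hrate hs hst 1

theorem measurableSet_eventCount (hE : IsPoissonProcess P rate E) {s t : ℝ} (hs : 0 ≤ s)
    (hst : s ≤ t) (K : Set ℕ∞) : MeasurableSet {ω | eventCount E s t ω ∈ K} :=
  hE.measurable_eventCount hs hst (show MeasurableSet[⊤] K from trivial)

variable [IsProbabilityMeasure P]

theorem measureReal_eventCount_ne_zero_le (hE : IsPoissonProcess P rate E)
    (hrate : ContinuousOn rate (Ioi 0)) {s t : ℝ} (hs : 0 < s) (hst : s ≤ t) :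
    P.real {ω | eventCount E s t ω ≠ 0} ≤ ∫ u in s..t, rate u := by
  have h : {ω | eventCount E s t ω ≠ 0} = {ω | eventCount E s t ω = 0}ᶜ := rfl
  rw [h, probReal_compl_eq_one_sub (hE.measurable_count s t hs.le hst 0),
    hE.measureReal_eventCount_eq_zero hrate hs hst]
  linarith [Real.add_one_le_exp (-∫ u in s..t, rate u)]

theorem measureReal_eventCount_gt_one_le (hE : IsPoissonProcess P rate E)
    (hrate : ContinuousOn rate (Ioi 0)) (hnonneg : ∀ t, 0 < t → 0 ≤ rate t) {s t : ℝ}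
    (hs : 0 < s) (hst : s ≤ t) :
    P.real {ω | eventCount E s t ω ∉ ({0, 1} : Set ℕ∞)} ≤ (∫ u in s..t, rate u) ^ 2 := by
  have hm0 := hE.measurable_count s t hs.le hst 0
  have hm1 := hE.measurable_count s t hs.le hst 1
  have h : {ω | eventCount E s t ω ∉ ({0, 1} : Set ℕ∞)} =
      ({ω | eventCount E s t ω = 0} ∪ {ω | eventCount E s t ω = 1})ᶜ := by
    ext ω; simp
  rw [h, probReal_compl_eq_one_sub (hm0.union hm1), measureReal_union _ hm1,
    hE.measureReal_eventCount_eq_zero hrate hs hst, hE.measureReal_eventCount_eq_one hrate hs hst]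
  -- With `x` the integral of the rate: `1 - (1 + x) exp (-x) ≤ 1 - (1 + x) (1 - x) = x ^ 2`, using
  -- `x ≥ 0`.
  · have h0 := integral_rate_nonneg hnonneg hs hst
    have h1 := Real.add_one_le_exp (-∫ u in s..t, rate u)
    nlinarith
  · rw [disjoint_left]
    intro ω h0 h1
    simp_all

/-- An event at `u` is an event in `(s, u]` for every `s < u`, which has probability at most `∫
rate` over that interval, and this tends to `0` as `s → u`. -/
theorem ae_notMem (hE : IsPoissonProcess P rate E)
    (hrate : ContinuousOn rate (Ioi 0)) {u : ℝ} (hu : 0 < u) : ∀ᵐ ω ∂P, u ∉ E ω := by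
  simp only [ae_iff, not_not]
  rw [← measureReal_eq_zero_iff]
  refine le_antisymm (ge_of_tendsto (f := fun s => ∫ x in s..u, rate x) (x := 𝓝[<] u) ?_ ?_)
    measureReal_nonneg
  · have hcont : ContinuousAt (fun s => ∫ x in u..s, rate x) u :=
      (intervalIntegral.integral_hasDerivAt_right (by simp)
        (hrate.stronglyMeasurableAtFilter isOpen_Ioi u hu)
        (hrate.continuousAt (Ioi_mem_nhds hu))).continuousAt
    have h : Tendsto (fun s => -∫ x in u..s, rate x) (𝓝[<] u) (𝓝 (-∫ x in u..u, rate x)) :=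
      hcont.neg.tendsto.mono_left nhdsWithin_le_nhds
    simpa [intervalIntegral.integral_symm u] using h
  · filter_upwards [self_mem_nhdsWithin, mem_nhdsWithin_of_mem_nhds (Ioi_mem_nhds hu)] with s hs h0
    refine (measureReal_mono fun ω hω => ?_).trans
      (hE.measureReal_eventCount_ne_zero_le hrate h0 (le_of_lt hs))
    rw [mem_ofPred_eq, eventCount, Ne, encard_eq_zero]
    exact nonempty_iff_ne_empty.1 ⟨u, hω, hs, le_rfl⟩

end IsPoissonProcess

end Poisson

/-! ### Means restricted to a set of velocities. -/

noncomputable section CellMean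

/-- The mean of `f (X u - a u)` over the event that the velocity at time `u` lies in `D`,
where `X` is the position. -/
def cellMean {Ω : Type*} [MeasurableSpace Ω] (P : Measure Ω) (V : ℝ → Ω → ℝ) (f : ℝ → ℝ) (a : ℝ)
    (D : Set ℝ) (u : ℝ) : ℝ :=
  ∫ ω in V u ⁻¹' D, f (position V u ω - a * u) ∂P

/-- Given the past up to time `s` and a single event in `(s, t]`, velocity `w` at time `t` is
reached exactly from velocities in `D`, with probability `r`. -/
structure HasInflow {Ω : Type*} [MeasurableSpace Ω] (P : Measure Ω) (E : Ω → Set ℝ)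
    (V : ℝ → Ω → ℝ) (w : ℝ) (D : Set ℝ) (r : ℝ) : Prop where
  measurableSet : MeasurableSet D
  nonneg : 0 ≤ r
  switch : ∀ s t : ℝ, 0 ≤ s → s ≤ t → ∀ A : Set Ω, MeasurableSet[motionHistory E V s] A →
    P.real (A ∩ (V t ⁻¹' {w} ∩ {ω | eventCount E s t ω = 1})) =
      r * P.real (A ∩ (V s ⁻¹' D ∩ {ω | eventCount E s t ω = 1}))

variable {Ω : Type*} [MeasurableSpace Ω] {P : Measure Ω} {c : ℝ}
  {rate : ℝ → ℝ} {E : Ω → Set ℝ} {V : ℝ → Ω → ℝ}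

namespace IsStopMotionVelocity

theorem measurable_comp_position (hV : IsStopMotionVelocity P c rate E V) (hc : 0 < c) {f : ℝ → ℝ}
    (hf : Continuous f) (b : ℝ) {u : ℝ} (hu : 0 ≤ u) :
    Measurable fun ω => f (position V u ω + b) :=
  hf.measurable.comp ((hV.measurable_position hc hu).add_const b)

variable [IsProbabilityMeasure P]

theorem integrable_comp_position (hV : IsStopMotionVelocity P c rate E V) (hc : 0 < c) {f : ℝ → ℝ}
    (hf : Continuous f) {K : ℝ} (hK : ∀ x, |f x| ≤ K) (b : ℝ) {u : ℝ} (hu : 0 ≤ u) :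
    Integrable (fun ω => f (position V u ω + b)) P :=
  .of_bound (hV.measurable_comp_position hc hf b hu).aestronglyMeasurable K
    (.of_forall fun _ => hK _)

theorem abs_cellMean_le {f : ℝ → ℝ} {K : ℝ} (hK : ∀ x, |f x| ≤ K) (a : ℝ) (D : Set ℝ) (u : ℝ) :
    |cellMean P V f a D u| ≤ K := by
  have h := norm_setIntegral_le_of_norm_le_const (μ := P) (s := V u ⁻¹' D)
    (f := fun ω => f (position V u ω - a * u)) (measure_lt_top _ _) fun ω _ => hK _
  refine h.trans (mul_le_of_le_one_right ((abs_nonneg _).trans (hK 0)) measureReal_le_one)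

/-- Almost surely `u` is not an event. The velocity is then constant near `u` and the position is
Lipschitz, so the integrand is continuous at `u`, and dominated convergence applies. -/
theorem continuousAt_cellMean (hV : IsStopMotionVelocity P c rate E V) (hc : 0 < c)
    (hrate : ContinuousOn rate (Ioi 0)) {f : ℝ → ℝ} (hf : Continuous f) {K : ℝ}
    (hK : ∀ x, |f x| ≤ K) (a : ℝ) {D : Set ℝ} (hD : MeasurableSet D) {u : ℝ} (hu : 0 < u) :
    ContinuousAt (cellMean P V f a D) u := by
  have hpos : ∀ᶠ v : ℝ in 𝓝 u, 0 < v := Ioi_mem_nhds hu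
  have heq : (fun v => ∫ ω, (V v ⁻¹' D).indicator (fun ω => f (position V v ω - a * v)) ω ∂P)
      =ᶠ[𝓝 u] cellMean P V f a D := by
    filter_upwards [hpos] with v hv
    exact integral_indicator (hV.measurable_velocity v hv.le hD)
  refine ContinuousAt.congr (continuousAt_of_dominated (bound := fun _ => K) ?_ ?_ ?_ ?_) heq
  · filter_upwards [hpos] with v hv
    simp only [sub_eq_add_neg]
    exact ((hV.measurable_comp_position hc hf _ hv.le).indicator
      (hV.measurable_velocity v hv.le hD)).aestronglyMeasurable
  · refine .of_forall fun v => .of_forall fun ω => ?_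
    exact (norm_indicator_le_norm_self _ _).trans (hK _)
  · exact integrable_const K
  · filter_upwards [hV.poisson.ae_notMem hrate hu] with ω hω
    have hposition : ContinuousAt (fun v => position V v ω) u := by
      refine tendsto_iff_norm_sub_tendsto_zero.2 (squeeze_zero' (.of_forall fun _ => norm_nonneg _)
        (hpos.mono fun v hv => hV.abs_position_sub_le hc hu.le hv.le ω) ?_)
      have : ContinuousAt (fun v => c * |v - u|) u := by fun_prop
      simpa [ContinuousAt] using this
    by_cases h : V u ω ∈ D
    · refine ContinuousAt.congr (f := fun v => f (position V v ω - a * v))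
        (hf.continuousAt.comp (hposition.sub (by fun_prop))) ?_
      filter_upwards [hV.velocity_eventuallyEq hu hω] with v hv
      rw [indicator_of_mem]
      simpa [hv] using h
    · refine ContinuousAt.congr (f := fun _ => (0 : ℝ)) continuousAt_const ?_
      filter_upwards [hV.velocity_eventuallyEq hu hω] with v hv
      rw [indicator_of_notMem]
      simpa [hv] using h

end IsStopMotionVelocity

end CellMean

/-! ### The forward equation for the restricted means. -/

section RightDerivative

variable {Ω : Type*} [MeasurableSpace Ω] {P : Measure Ω} {c : ℝ}
  {rate : ℝ → ℝ} {E : Ω → Set ℝ} {V : ℝ → Ω → ℝ} {w : ℝ} {D : Set ℝ} {r : ℝ}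

namespace IsStopMotionVelocity

theorem measureReal_inter_eventCount (hV : IsStopMotionVelocity P c rate E V) {s t : ℝ}
    (hs : 0 ≤ s) (hst : s ≤ t) {A : Set Ω} (hA : MeasurableSet[motionHistory E V s] A) (k : ℕ∞) :
    P.real (A ∩ {ω | eventCount E s t ω = k}) =
      P.real {ω | eventCount E s t ω = k} * P.real A := by
  have h := (Indep_iff _ _ P).1 (hV.indep_future s t hs hst) {ω | eventCount E s t ω = k} A
    ⟨{k}, trivial, rfl⟩ hA
  rw [inter_comm, measureReal_def, h, ENNReal.toReal_mul, measureReal_def, measureReal_def]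

theorem stronglyMeasurable_history_comp (hV : IsStopMotionVelocity P c rate E V) (hc : 0 < c)
    {f : ℝ → ℝ} (hf : Continuous f) (b : ℝ) (hD : MeasurableSet D) {u : ℝ} (hu : 0 ≤ u) :
    StronglyMeasurable[motionHistory E V u]
      ((V u ⁻¹' D).indicator fun ω => f (position V u ω + b)) :=
  Measurable.stronglyMeasurable <| Measurable.indicator
    (hf.measurable.comp ((hV.measurable_position_history hc hu).add_const b))
    (measurable_velocity_history hu le_rfl hD)

variable [IsProbabilityMeasure P]

theorem setIntegral_eventCount (hV : IsStopMotionVelocity P c rate E V) {s t : ℝ}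
    (hs : 0 ≤ s) (hst : s ≤ t) {F : Ω → ℝ} (hF : StronglyMeasurable[motionHistory E V s] F)
    (k : ℕ∞) :
    ∫ ω in {ω | eventCount E s t ω = k}, F ω ∂P =
      P.real {ω | eventCount E s t ω = k} * ∫ ω, F ω ∂P := by
  have h := setIntegral_eq_mul_of_forall_measureReal (P := P) (hV.motionHistory_le s)
    (B₁ := {ω | eventCount E s t ω = k}) (B₂ := univ) (r := P.real {ω | eventCount E s t ω = k})
    measureReal_nonneg
    (fun A hA => by rw [inter_univ]; exact hV.measureReal_inter_eventCount hs hst hA k) hF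
  rwa [setIntegral_univ] at h

/-- The contribution of paths without an event in `(s, t]`. -/
theorem setIntegral_no_event (hV : IsStopMotionVelocity P c rate E V) (hc : 0 < c)
    {f : ℝ → ℝ} (hf : Continuous f) (a : ℝ) {s t : ℝ} (hs : 0 ≤ s) (hst : s ≤ t) :
    ∫ ω in V t ⁻¹' {w} ∩ {ω | eventCount E s t ω = 0}, f (position V t ω - a * t) ∂P =
      P.real {ω | eventCount E s t ω = 0} *
        ∫ ω in V s ⁻¹' {w}, f (position V s ω + (-(a * s) + (t - s) * (w - a))) ∂P := by
  have hset : V t ⁻¹' {w} ∩ {ω | eventCount E s t ω = 0} =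
      {ω | eventCount E s t ω = 0} ∩ V s ⁻¹' {w} := by
    ext ω
    simp only [mem_inter_iff, mem_preimage, mem_singleton_iff, mem_ofPred_eq]
    constructor
    · rintro ⟨h1, h0⟩
      exact ⟨h0, (hV.const_between s t hs hst ω h0).symm.trans h1⟩
    · rintro ⟨h0, h1⟩
      exact ⟨(hV.const_between s t hs hst ω h0).trans h1, h0⟩
  have hm0 := hV.poisson.measurable_count s t hs hst 0
  have hmw := hV.measurable_velocity s hs (measurableSet_singleton w)
  rw [hset, ← integral_indicator hmw, ← hV.setIntegral_eventCount hs hst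
    (hV.stronglyMeasurable_history_comp hc hf _ (measurableSet_singleton w) hs) 0,
    setIntegral_indicator hmw]
  refine setIntegral_congr_fun (hm0.inter hmw) fun ω hω => ?_
  have h1 : V s ω = w := hω.2
  rw [hV.position_eq_of_eventCount_eq_zero hc hs hst hω.1, h1]
  congr 1
  ring

/-- The main contribution of paths with exactly one event in `(s, t]`. -/
theorem setIntegral_one_event (hV : IsStopMotionVelocity P c rate E V) (hc : 0 < c)
    (hin : HasInflow P E V w D r) {f : ℝ → ℝ} (hf : Continuous f) (a : ℝ) {s t : ℝ} (hs : 0 ≤ s)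
    (hst : s ≤ t) :
    ∫ ω in V t ⁻¹' {w} ∩ {ω | eventCount E s t ω = 1}, f (position V s ω - a * s) ∂P =
      P.real {ω | eventCount E s t ω = 1} * (r * cellMean P V f a D s) := by
  have hmD := hV.measurable_velocity s hs hin.measurableSet
  have hF : StronglyMeasurable[motionHistory E V s] fun ω => f (position V s ω - a * s) :=
    (hf.measurable.comp
      ((hV.measurable_position_history hc hs).sub_const (a * s))).stronglyMeasurable
  rw [setIntegral_eq_mul_of_forall_measureReal (hV.motionHistory_le s) hin.nonneg
    (hin.switch s t hs hst) hF, mul_left_comm, cellMean, ← integral_indicator hmD,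
    ← hV.setIntegral_eventCount hs hst (by
      simpa only [sub_eq_add_neg] using
        hV.stronglyMeasurable_history_comp hc hf _ hin.measurableSet hs) 1,
    setIntegral_indicator hmD, inter_comm]

/-- Paths are split by whether `(s, t]` contains no event, one event or more. With one event,
replacing the position at `t` by that at `s` costs `O(t - s)` on a set of probability at most `∫
rate`; more events have probability at most `(∫ rate) ^ 2`. Both errors are `o(t - s)`. -/
theorem cellMean_eq_add_remainder (hV : IsStopMotionVelocity P c rate E V) (hc : 0 < c)
    (hrate : ContinuousOn rate (Ioi 0)) (hnonneg : ∀ t, 0 < t → 0 ≤ rate t)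
    (hin : HasInflow P E V w D r) {f f' : ℝ → ℝ} (hf : ∀ x, HasDerivAt f (f' x) x)
    {K : ℝ} (hK : ∀ x, |f x| ≤ K) (hK' : ∀ x, |f' x| ≤ K) (a : ℝ) {s t : ℝ} (hs : 0 < s)
    (hst : s ≤ t) :
    |cellMean P V f a {w} t -
        (Real.exp (-∫ u in s..t, rate u) *
            ∫ ω in V s ⁻¹' {w}, f (position V s ω + (-(a * s) + (t - s) * (w - a))) ∂P +
          (Real.exp (-∫ u in s..t, rate u) * ∫ u in s..t, rate u) * (r * cellMean P V f a D s))| ≤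
      K * (c + |a|) * (t - s) * (∫ u in s..t, rate u) + K * (∫ u in s..t, rate u) ^ 2 := by
  have ht : 0 < t := hs.trans_le hst
  have hfc : Continuous f := continuous_iff_continuousAt.2 fun x => (hf x).continuousAt
  have hK0 : 0 ≤ K := (abs_nonneg _).trans (hK 0)
  have hΛ := integral_rate_nonneg hnonneg hs hst
  set B := V t ⁻¹' {w} with hB
  have hmB : MeasurableSet B := hV.measurable_velocity t ht.le (measurableSet_singleton w)
  set N0 := {ω | eventCount E s t ω = 0} with hN0
  set N1 := {ω | eventCount E s t ω = 1} with hN1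
  set N2 := {ω | eventCount E s t ω ∉ ({0, 1} : Set ℕ∞)} with hN2
  have hm0 : MeasurableSet N0 := hV.poisson.measurable_count s t hs.le hst 0
  have hm1 : MeasurableSet N1 := hV.poisson.measurable_count s t hs.le hst 1
  have hm2 : MeasurableSet N2 := hV.poisson.measurableSet_eventCount hs.le hst ({0, 1}ᶜ)
  have hint : ∀ u, 0 ≤ u → Integrable (fun ω => f (position V u ω - a * u)) P := fun u hu => by
    simpa only [sub_eq_add_neg] using hV.integrable_comp_position hc hfc hK (-(a * u)) hu
  have hsplit : cellMean P V f a {w} t =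
      ∫ ω in B ∩ N0, f (position V t ω - a * t) ∂P +
        (∫ ω in B ∩ N1, f (position V t ω - a * t) ∂P +
          ∫ ω in B ∩ N2, f (position V t ω - a * t) ∂P) := by
    have h : B = (B ∩ N0) ∪ ((B ∩ N1) ∪ (B ∩ N2)) := by
      ext ω
      simp only [hN0, hN1, hN2, mem_union, mem_inter_iff, mem_ofPred_eq, mem_insert_iff,
        mem_singleton_iff]
      tauto
    have hd1 : Disjoint (B ∩ N1) (B ∩ N2) := by
      rw [disjoint_left]
      rintro ω ⟨-, h1⟩ ⟨-, h2⟩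
      exact h2 (Or.inr h1)
    have hd0 : Disjoint (B ∩ N0) ((B ∩ N1) ∪ (B ∩ N2)) := by
      rw [disjoint_left]
      rintro ω ⟨-, h0⟩ (⟨-, h1⟩ | ⟨-, h2⟩)
      · exact zero_ne_one ((Eq.symm h0).trans h1)
      · exact h2 (Or.inl h0)
    rw [cellMean, ← hB]
    nth_rewrite 1 [h]
    rw [setIntegral_union hd0 ((hmB.inter hm1).union (hmB.inter hm2)) (hint t ht.le).integrableOn
      (hint t ht.le).integrableOn, setIntegral_union hd1 (hmB.inter hm2)
      (hint t ht.le).integrableOn (hint t ht.le).integrableOn]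
  have hone : |∫ ω in B ∩ N1, f (position V t ω - a * t) ∂P -
      ∫ ω in B ∩ N1, f (position V s ω - a * s) ∂P| ≤
      K * (c + |a|) * (t - s) * ∫ u in s..t, rate u := by
    rw [← integral_sub (hint t ht.le).integrableOn (hint s hs.le).integrableOn]
    have hlip : ∀ x y, |f x - f y| ≤ K * |x - y| := fun x y =>
      convex_univ.norm_image_sub_le_of_norm_hasDerivWithin_le (f := f) (f' := f')
        (fun z _ => (hf z).hasDerivWithinAt) (fun z _ => hK' z) (mem_univ y) (mem_univ x)
    have hts : 0 ≤ t - s := sub_nonneg.2 hst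
    refine (norm_setIntegral_le_of_norm_le_const (μ := P) (s := B ∩ N1)
      (f := fun ω => f (position V t ω - a * t) - f (position V s ω - a * s))
      (C := K * (c + |a|) * (t - s)) (measure_lt_top _ _) fun ω _ => ?_).trans ?_
    · refine (hlip _ _).trans ?_
      rw [mul_assoc]
      refine mul_le_mul_of_nonneg_left ?_ hK0
      have h1 := hV.abs_position_sub_le hc hs.le ht.le ω
      rw [abs_of_nonneg hts] at h1
      calc |position V t ω - a * t - (position V s ω - a * s)|
          = |(position V t ω - position V s ω) - a * (t - s)| := by congr 1; ring
        _ ≤ |position V t ω - position V s ω| + |a * (t - s)| := abs_sub _ _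
        _ ≤ (c + |a|) * (t - s) := by rw [abs_mul, abs_of_nonneg hts]; linarith
    · refine mul_le_mul_of_nonneg_left ((measureReal_mono fun ω hω => ?_).trans
        (hV.poisson.measureReal_eventCount_ne_zero_le hrate hs hst)) (by positivity)
      have h1 : eventCount E s t ω = 1 := hω.2
      simp [h1]
  have htwo : |∫ ω in B ∩ N2, f (position V t ω - a * t) ∂P| ≤
      K * (∫ u in s..t, rate u) ^ 2 := by
    refine (norm_setIntegral_le_of_norm_le_const (μ := P) (s := B ∩ N2)
      (f := fun ω => f (position V t ω - a * t)) (C := K) (measure_lt_top _ _) fun ω _ => hK _).trans ?_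
    exact mul_le_mul_of_nonneg_left ((measureReal_mono inter_subset_right).trans
      (hV.poisson.measureReal_eventCount_gt_one_le hrate hnonneg hs hst)) hK0
  have hzero := hV.setIntegral_no_event hc (w := w) hfc a hs.le hst
  have hin1 := hV.setIntegral_one_event hc hin hfc a hs.le hst
  rw [hV.poisson.measureReal_eventCount_eq_zero hrate hs hst] at hzero
  rw [hV.poisson.measureReal_eventCount_eq_one hrate hs hst] at hin1
  rw [hsplit, ← hzero, ← hin1]
  calc _ = |(∫ ω in B ∩ N1, f (position V t ω - a * t) ∂P -
        ∫ ω in B ∩ N1, f (position V s ω - a * s) ∂P) +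
          ∫ ω in B ∩ N2, f (position V t ω - a * t) ∂P| := by congr 1; ring
    _ ≤ _ := (abs_add_le _ _).trans (add_le_add hone htwo)

theorem hasDerivAt_integral_translate (hV : IsStopMotionVelocity P c rate E V) (hc : 0 < c)
    {f f' : ℝ → ℝ} (hf : ∀ x, HasDerivAt f (f' x) x) (hf' : Continuous f')
    {K : ℝ} (hK : ∀ x, |f x| ≤ K) (hK' : ∀ x, |f' x| ≤ K) (a b : ℝ) (B : Set Ω) {s : ℝ}
    (hs : 0 ≤ s) :
    HasDerivAt (fun t => ∫ ω in B, f (position V s ω + (-(a * s) + (t - s) * b)) ∂P)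
      (b * ∫ ω in B, f' (position V s ω - a * s) ∂P) s := by
  have hfc : Continuous f := continuous_iff_continuousAt.2 fun x => (hf x).continuousAt
  have h := (hasDerivAt_integral_of_dominated_loc_of_deriv_le (μ := P.restrict B)
    (F := fun t ω => f (position V s ω + (-(a * s) + (t - s) * b)))
    (F' := fun t ω => f' (position V s ω + (-(a * s) + (t - s) * b)) * b)
    (x₀ := s) (s := univ) (bound := fun _ => K * |b|) univ_mem ?_ ?_ ?_ ?_ ?_ ?_).2
  · have h2 : b * ∫ ω in B, f' (position V s ω - a * s) ∂P =
        ∫ ω in B, f' (position V s ω + (-(a * s) + (s - s) * b)) * b ∂P := by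
      rw [integral_mul_const, mul_comm]
      simp [sub_eq_add_neg]
    rw [h2]
    exact h
  · exact .of_forall fun t => (hV.measurable_comp_position hc hfc _ hs).aestronglyMeasurable
  · exact (hV.integrable_comp_position hc hfc hK _ hs).integrableOn
  · exact ((hV.measurable_comp_position hc hf' _ hs).mul_const b).aestronglyMeasurable
  · refine .of_forall fun ω t _ => ?_
    rw [norm_mul]
    exact mul_le_mul_of_nonneg_right (hK' _) (norm_nonneg _)
  · exact integrable_const _
  · refine .of_forall fun ω t _ => ?_
    have h1 : HasDerivAt (fun t => position V s ω + (-(a * s) + (t - s) * b)) b t := by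
      simpa using ((((hasDerivAt_id t).sub_const s).mul_const b).const_add (-(a * s))).const_add
        (position V s ω)
    exact (hf _).comp t h1

/-- The explicit main term `G` is differentiable, and the error is dominated by a function `b` that
vanishes at `s` together with its derivative. Conditioning on the past only looks forward, so this
gives the derivative from the right. -/
theorem cellMean_hasDerivWithinAt (hV : IsStopMotionVelocity P c rate E V) (hc : 0 < c)
    (hrate : ContinuousOn rate (Ioi 0)) (hnonneg : ∀ t, 0 < t → 0 ≤ rate t)
    (hin : HasInflow P E V w D r) {f f' : ℝ → ℝ} (hf : ∀ x, HasDerivAt f (f' x) x)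
    (hf' : Continuous f') {K : ℝ} (hK : ∀ x, |f x| ≤ K) (hK' : ∀ x, |f' x| ≤ K) (a : ℝ) {s : ℝ}
    (hs : 0 < s) :
    HasDerivWithinAt (cellMean P V f a {w})
      ((w - a) * cellMean P V f' a {w} s +
        rate s * (r * cellMean P V f a D s - cellMean P V f a {w} s)) (Ioi s) s := by
  set Λ : ℝ → ℝ := fun t => ∫ u in s..t, rate u with hΛ
  have hΛs : Λ s = 0 := intervalIntegral.integral_same
  have hdΛ : HasDerivAt Λ (rate s) s :=
    intervalIntegral.integral_hasDerivAt_right (by simp)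
      (hrate.stronglyMeasurableAtFilter isOpen_Ioi s hs) (hrate.continuousAt (Ioi_mem_nhds hs))
  have hdA := hV.hasDerivAt_integral_translate hc hf hf' hK hK' a (w - a) (V s ⁻¹' {w}) hs.le
  set A : ℝ → ℝ := fun t =>
    ∫ ω in V s ⁻¹' {w}, f (position V s ω + (-(a * s) + (t - s) * (w - a))) ∂P with hA
  have hAs : A s = cellMean P V f a {w} s := by simp [hA, cellMean, sub_eq_add_neg]
  set G : ℝ → ℝ := fun t => Real.exp (-Λ t) * A t +
    (Real.exp (-Λ t) * Λ t) * (r * cellMean P V f a D s) with hG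
  have hdG : HasDerivAt G ((w - a) * cellMean P V f' a {w} s +
      rate s * (r * cellMean P V f a D s - cellMean P V f a {w} s)) s := by
    have hexp : HasDerivAt (fun t => Real.exp (-Λ t)) (-rate s) s := by
      simpa [hΛs] using hdΛ.neg.exp
    refine ((hexp.mul hdA).add ((hexp.mul hdΛ).mul_const _)).congr_deriv ?_
    rw [hAs]
    simp only [hΛs, neg_zero, Real.exp_zero, cellMean]
    ring
  have hGs : G s = cellMean P V f a {w} s := by simp [hG, hΛs, hAs]
  set b : ℝ → ℝ := fun t => K * (c + |a|) * (t - s) * Λ t + K * Λ t ^ 2 with hb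
  have hdb : HasDerivAt b 0 s := by
    refine (((((hasDerivAt_id s).sub_const s).const_mul (K * (c + |a|))).mul hdΛ).add
      ((hdΛ.pow 2).const_mul K)).congr_deriv ?_
    simp [hΛs]
  have hbs : b s = 0 := by simp [hb, hΛs]
  have hR : HasDerivWithinAt (fun t => cellMean P V f a {w} t - G t) 0 (Ioi s) s := by
    rw [hasDerivWithinAt_iff_isLittleO]
    have hbo := hdb.hasDerivWithinAt (s := Ioi s)
    rw [hasDerivWithinAt_iff_isLittleO] at hbo
    refine Asymptotics.IsBigO.trans_isLittleO (.of_bound 1 ?_) hbo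
    filter_upwards [self_mem_nhdsWithin] with t ht
    simp only [hGs, hbs, sub_self, smul_zero, sub_zero, one_mul]
    exact (hV.cellMean_eq_add_remainder hc hrate hnonneg hin hf hK hK' a hs (le_of_lt ht)).trans
      (le_abs_self _)
  refine ((hR.add (hdG.hasDerivWithinAt (s := Ioi s))).congr_of_eventuallyEq
    (.of_forall fun t => ?_) ?_).congr_deriv (zero_add _) <;> simp

/-- The right derivative is itself continuous in time, and so is the mean; the mean is therefore the
integral of its right derivative, which makes it differentiable from both sides. -/
theorem cellMean_hasDerivAt (hV : IsStopMotionVelocity P c rate E V) (hc : 0 < c)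
    (hrate : ContinuousOn rate (Ioi 0)) (hnonneg : ∀ t, 0 < t → 0 ≤ rate t)
    (hin : HasInflow P E V w D r) {f f' : ℝ → ℝ} (hf : ∀ x, HasDerivAt f (f' x) x)
    (hf' : Continuous f') {K : ℝ} (hK : ∀ x, |f x| ≤ K) (hK' : ∀ x, |f' x| ≤ K) (a : ℝ) {s : ℝ}
    (hs : 0 < s) :
    HasDerivAt (cellMean P V f a {w})
      ((w - a) * cellMean P V f' a {w} s +
        rate s * (r * cellMean P V f a D s - cellMean P V f a {w} s)) s := by
  have hfc : Continuous f := continuous_iff_continuousAt.2 fun x => (hf x).continuousAt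
  set g : ℝ → ℝ := fun u => (w - a) * cellMean P V f' a {w} u +
    rate u * (r * cellMean P V f a D u - cellMean P V f a {w} u) with hg
  have hw := measurableSet_singleton w
  have hcm : ∀ u, 0 < u → ContinuousAt (cellMean P V f a {w}) u := fun u hu =>
    hV.continuousAt_cellMean hc hrate hfc hK a hw hu
  have hgc : ContinuousOn g (Ioi 0) := fun u hu => by
    have h1 := hV.continuousAt_cellMean hc hrate hf' hK' a hw hu
    have h2 := hV.continuousAt_cellMean hc hrate hfc hK a hin.measurableSet hu
    have h3 := hrate.continuousAt (Ioi_mem_nhds hu)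
    have h4 := hcm u hu
    exact (ContinuousAt.add (continuousAt_const.mul h1)
      (h3.mul ((continuousAt_const.mul h2).sub h4))).continuousWithinAt
  -- The integration starts at `s / 2` because the rate may be singular at time `0`.
  have hs2 : 0 < s / 2 := half_pos hs
  have hint : ∀ t, s / 2 < t →
      cellMean P V f a {w} t = cellMean P V f a {w} (s / 2) + ∫ u in (s / 2)..t, g u := by
    intro t ht
    rw [intervalIntegral.integral_eq_sub_of_hasDeriv_right_of_le (f := cellMean P V f a {w}) ht.le]
    · ring
    · exact fun u hu => (hcm u (hs2.trans_le hu.1)).continuousWithinAt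
    · exact fun u hu => hV.cellMean_hasDerivWithinAt hc hrate hnonneg hin hf hf' hK hK' a
        (hs2.trans hu.1)
    · exact (hgc.mono fun x hx => (lt_min hs2 (hs2.trans ht)).trans_le hx.1).intervalIntegrable
  have hd : HasDerivAt (fun t => cellMean P V f a {w} (s / 2) + ∫ u in (s / 2)..t, g u) (g s) s :=
    (intervalIntegral.integral_hasDerivAt_right
      ((hgc.mono fun x hx => (lt_min hs2 hs).trans_le hx.1).intervalIntegrable)
      (hgc.stronglyMeasurableAtFilter isOpen_Ioi s hs)
      (hgc.continuousAt (Ioi_mem_nhds hs))).const_add _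
  refine hd.congr_of_eventuallyEq ?_
  filter_upwards [Ioi_mem_nhds (half_lt_self hs)] with t ht using hint t ht

end IsStopMotionVelocity

end RightDerivative

/-! ### Elimination: from the first-order system to the third-order equation. -/

theorem iteratedDeriv_eq_of_hasDerivAt {U : Set ℝ} (hU : IsOpen U) {f f₁ f₂ f₃ : ℝ → ℝ}
    (h₁ : ∀ t ∈ U, HasDerivAt f (f₁ t) t) (h₂ : ∀ t ∈ U, HasDerivAt f₁ (f₂ t) t)
    (h₃ : ∀ t ∈ U, HasDerivAt f₂ (f₃ t) t) {t : ℝ} (ht : t ∈ U) :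
    deriv f t = f₁ t ∧ iteratedDeriv 2 f t = f₂ t ∧ iteratedDeriv 3 f t = f₃ t := by
  have e₁ : ∀ s ∈ U, deriv f s = f₁ s := fun s hs => (h₁ s hs).deriv
  have e₂ : ∀ s ∈ U, iteratedDeriv 2 f s = f₂ s := fun s hs => by
    rw [iteratedDeriv_succ, iteratedDeriv_one]
    exact (EventuallyEq.deriv_eq (by filter_upwards [hU.mem_nhds hs] with x hx using e₁ x hx)).trans
      (h₂ s hs).deriv
  refine ⟨e₁ t ht, e₂ t ht, ?_⟩
  rw [iteratedDeriv_succ]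
  exact (EventuallyEq.deriv_eq (by filter_upwards [hU.mem_nhds ht] with x hx using e₂ x hx)).trans
    (h₃ t ht).deriv

theorem contDiffAt_three_of_hasDerivAt {U : Set ℝ} (hU : IsOpen U) {f f₁ f₂ f₃ : ℝ → ℝ}
    (h₁ : ∀ t ∈ U, HasDerivAt f (f₁ t) t) (h₂ : ∀ t ∈ U, HasDerivAt f₁ (f₂ t) t)
    (h₃ : ∀ t ∈ U, HasDerivAt f₂ (f₃ t) t) (hc : ContinuousOn f₃ U) {t : ℝ} (ht : t ∈ U) :
    ContDiffAt ℝ 3 f t := by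
  have step : ∀ {g g' : ℝ → ℝ} {n : ℕ}, (∀ t ∈ U, HasDerivAt g (g' t) t) →
      ContDiffOn ℝ n g' U → ContDiffOn ℝ (n + 1 : ℕ) g U := fun {g g' n} hg hg' => by
    rw [Nat.cast_add, Nat.cast_one, contDiffOn_succ_iff_deriv_of_isOpen hU]
    refine ⟨fun t ht => (hg t ht).differentiableAt.differentiableWithinAt, by simp,
      hg'.congr fun t ht => (hg t ht).deriv⟩
  have h : ContDiffOn ℝ (3 : ℕ) f U :=
    step h₁ (step h₂ (step h₃ (n := 0) (contDiffOn_zero.2 hc)))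
  exact_mod_cast h.contDiffAt (hU.mem_nhds ht)

/-- The third-order equation obtained from the first-order system for the means restricted to
the three velocities `c`, `-c`, `0`. -/
theorem stopMotion_thirdOrder {c : ℝ} {rate : ℝ → ℝ} (hrate : ContDiffOn ℝ 1 rate (Ioi 0))
    {A B Z : ℕ → ℝ → ℝ}
    (hA : ∀ k ≤ 2, ∀ t, 0 < t → HasDerivAt (A k)
      (c * A (k + 1) t + rate t * (1 / 2 * Z k t - A k t)) t)
    (hB : ∀ k ≤ 2, ∀ t, 0 < t → HasDerivAt (B k)
      (-c * B (k + 1) t + rate t * (1 / 2 * Z k t - B k t)) t)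
    (hZ : ∀ k ≤ 2, ∀ t, 0 < t → HasDerivAt (Z k) (rate t * (A k t + B k t - Z k t)) t)
    (hA3 : ContinuousOn (A 3) (Ioi 0)) (hB3 : ContinuousOn (B 3) (Ioi 0))
    {M M2 : ℝ → ℝ} (hM : ∀ t, 0 < t → M t = A 0 t + B 0 t + Z 0 t)
    (hM2 : ∀ t, 0 < t → M2 t = A 2 t + B 2 t + Z 2 t) {t : ℝ} (ht : 0 < t) :
    ContDiffAt ℝ 3 M t ∧
      iteratedDeriv 3 M t + 3 * rate t * iteratedDeriv 2 M t +
          (2 * rate t ^ 2 + deriv rate t) * deriv M t =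
        c ^ 2 * deriv M2 t + c ^ 2 * rate t * M2 t := by
  have hdrate : ∀ s, 0 < s → HasDerivAt rate (deriv rate s) s := fun s hs =>
    ((hrate.differentiableOn (by simp)).differentiableAt (Ioi_mem_nhds hs)).hasDerivAt
  have hcrate : ContinuousOn (deriv rate) (Ioi 0) :=
    hrate.continuousOn_deriv_of_isOpen isOpen_Ioi le_rfl
  -- In the sum over the three velocities the jump terms cancel and only transport remains.
  have hsum : ∀ k ≤ 2, ∀ s, 0 < s → HasDerivAt (fun s => A k s + B k s + Z k s)
      (c * (A (k + 1) s - B (k + 1) s)) s := fun k hk s hs =>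
    (((hA k hk s hs).add (hB k hk s hs)).add (hZ k hk s hs)).congr_deriv (by ring)
  have hd₁ : ∀ s ∈ Ioi (0 : ℝ), HasDerivAt M (c * (A 1 s - B 1 s)) s := fun s hs =>
    (hsum 0 (by norm_num) s hs).congr_of_eventuallyEq (by
      filter_upwards [Ioi_mem_nhds hs] with x hx using hM x hx)
  -- The inflow from velocity `0` is the same for `c` and `-c`, so in the difference only the
  -- damping survives.
  have hd₂ : ∀ s ∈ Ioi (0 : ℝ), HasDerivAt (fun s => c * (A 1 s - B 1 s))
      (c ^ 2 * (A 2 s + B 2 s) - rate s * (c * (A 1 s - B 1 s))) s := fun s hs =>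
    (((hA 1 (by norm_num) s hs).sub (hB 1 (by norm_num) s hs)).const_mul c).congr_deriv (by ring)
  have hd₃ : ∀ s ∈ Ioi (0 : ℝ), HasDerivAt
      (fun s => c ^ 2 * (A 2 s + B 2 s) - rate s * (c * (A 1 s - B 1 s)))
      (c ^ 2 * (c * (A 3 s - B 3 s) + rate s * (Z 2 s - A 2 s - B 2 s)) -
        (deriv rate s * (c * (A 1 s - B 1 s)) +
          rate s * (c ^ 2 * (A 2 s + B 2 s) - rate s * (c * (A 1 s - B 1 s))))) s := fun s hs =>
    ((((hA 2 le_rfl s hs).add (hB 2 le_rfl s hs)).const_mul (c ^ 2)).sub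
      ((hdrate s hs).mul (hd₂ s hs))).congr_deriv (by ring)
  have hcont : ∀ {g g' : ℝ → ℝ}, (∀ s, 0 < s → HasDerivAt g (g' s) s) → ContinuousOn g (Ioi 0) :=
    fun h s hs => (h s hs).continuousAt.continuousWithinAt
  have cA : ∀ k ≤ 2, ContinuousOn (A k) (Ioi 0) := fun k hk => hcont (hA k hk)
  have cB : ∀ k ≤ 2, ContinuousOn (B k) (Ioi 0) := fun k hk => hcont (hB k hk)
  have cZ : ∀ k ≤ 2, ContinuousOn (Z k) (Ioi 0) := fun k hk => hcont (hZ k hk)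
  have cA1 := cA 1 (by norm_num)
  have cB1 := cB 1 (by norm_num)
  have cA2 := cA 2 le_rfl
  have cB2 := cB 2 le_rfl
  have cZ2 := cZ 2 le_rfl
  have cr := hrate.continuousOn
  have hc3 : ContinuousOn (fun s =>
      c ^ 2 * (c * (A 3 s - B 3 s) + rate s * (Z 2 s - A 2 s - B 2 s)) -
        (deriv rate s * (c * (A 1 s - B 1 s)) +
          rate s * (c ^ 2 * (A 2 s + B 2 s) - rate s * (c * (A 1 s - B 1 s))))) (Ioi 0) := by
    fun_prop
  refine ⟨contDiffAt_three_of_hasDerivAt isOpen_Ioi hd₁ hd₂ hd₃ hc3 ht, ?_⟩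
  obtain ⟨e₁, e₂, e₃⟩ := iteratedDeriv_eq_of_hasDerivAt isOpen_Ioi hd₁ hd₂ hd₃ ht
  have hdM2 : deriv M2 t = c * (A 3 t - B 3 t) :=
    ((hsum 2 le_rfl t ht).congr_of_eventuallyEq (by
      filter_upwards [Ioi_mem_nhds ht] with x hx using hM2 x hx)).deriv
  -- `Z 2` is eliminated through `Z 2 - A 2 - B 2 = M2 - 2 (A 2 + B 2)` and `c ^ 2 (A 2 + B 2) = M''
  -- + λ M'`.
  rw [e₁, e₂, e₃, hdM2, hM2 t ht]
  ring

/-! ### Derivatives of test functions. -/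

section TestFunctions

theorem HasCompactSupport.iteratedDeriv_real {f : ℝ → ℝ} (hf : HasCompactSupport f) (k : ℕ) :
    HasCompactSupport (iteratedDeriv k f) := by
  induction k with
  | zero => simpa using hf
  | succ k ih => rw [iteratedDeriv_succ]; exact ih.deriv

theorem ContDiff.hasDerivAt_iteratedDeriv {f : ℝ → ℝ}
    (hf : ContDiff ℝ ((⊤ : ℕ∞) : WithTop ℕ∞) f) (k : ℕ) (x : ℝ) :
    HasDerivAt (iteratedDeriv k f) (iteratedDeriv (k + 1) f x) x := by
  rw [iteratedDeriv_succ]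
  exact (hf.differentiable_iteratedDeriv k (by exact_mod_cast WithTop.coe_lt_top k) x).hasDerivAt

theorem ContDiff.continuous_iteratedDeriv_of_smooth {f : ℝ → ℝ}
    (hf : ContDiff ℝ ((⊤ : ℕ∞) : WithTop ℕ∞) f) (k : ℕ) : Continuous (iteratedDeriv k f) :=
  continuous_iff_continuousAt.2 fun x => (hf.hasDerivAt_iteratedDeriv k x).continuousAt

theorem exists_abs_iteratedDeriv_le {f : ℝ → ℝ} (hf : ContDiff ℝ ((⊤ : ℕ∞) : WithTop ℕ∞) f)
    (hfc : HasCompactSupport f) (k : ℕ) : ∃ K, ∀ x, |iteratedDeriv k f x| ≤ K :=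
  (hf.continuous_iteratedDeriv_of_smooth k).bounded_above_of_compact_support
    (hfc.iteratedDeriv_real k)

end TestFunctions

/-! ### Switching rules as inflows, and the weak equation for the law. -/

section Law

variable {Ω : Type*} [MeasurableSpace Ω] {P : Measure Ω} {c : ℝ}
  {rate : ℝ → ℝ} {E : Ω → Set ℝ} {V : ℝ → Ω → ℝ}

namespace IsStopMotionVelocity

theorem cellMean_pair (hV : IsStopMotionVelocity P c rate E V) (hc : 0 < c)
    [IsProbabilityMeasure P] {f : ℝ → ℝ} (hf : Continuous f) {K : ℝ} (hK : ∀ x, |f x| ≤ K)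
    (a : ℝ) {u : ℝ} (hu : 0 ≤ u) :
    cellMean P V f a {c, -c} u = cellMean P V f a {c} u + cellMean P V f a {-c} u := by
  have hint : Integrable (fun ω => f (position V u ω - a * u)) P := by
    simpa only [sub_eq_add_neg] using hV.integrable_comp_position hc hf hK (-(a * u)) hu
  rw [cellMean, insert_eq, preimage_union, setIntegral_union _
    (hV.measurable_velocity u hu (measurableSet_singleton _)) hint.integrableOn hint.integrableOn]
  · rfl
  · refine Disjoint.preimage _ (disjoint_singleton.2 ?_)
    linarith

theorem compl_preimage_zero (hV : IsStopMotionVelocity P c rate E V) (hc : 0 < c) {u : ℝ}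
    (hu : 0 ≤ u) : (V u ⁻¹' {0})ᶜ = V u ⁻¹' {c} ∪ V u ⁻¹' {-c} := by
  ext ω
  have h := hV.velocity_mem u hu ω
  simp only [mem_compl_iff, mem_preimage, mem_singleton_iff, mem_union]
  constructor
  · tauto
  · rintro (h | h) <;> rw [h]
    · exact hc.ne'
    · exact neg_ne_zero.2 hc.ne'

theorem integral_eq_add_velocity (hV : IsStopMotionVelocity P c rate E V) (hc : 0 < c)
    {F : Ω → ℝ} (hF : Integrable F P) {u : ℝ} (hu : 0 ≤ u) :
    ∫ ω, F ω ∂P = ∫ ω in V u ⁻¹' {c}, F ω ∂P + ∫ ω in V u ⁻¹' {-c}, F ω ∂P +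
      ∫ ω in V u ⁻¹' {0}, F ω ∂P := by
  have hm := fun v => hV.measurable_velocity u hu (measurableSet_singleton v)
  rw [← integral_add_compl (hm 0) hF, add_comm, hV.compl_preimage_zero hc hu,
    setIntegral_union (Disjoint.preimage _ (disjoint_singleton.2 (by linarith))) (hm (-c))
      hF.integrableOn hF.integrableOn]

theorem integral_comp_position (hV : IsStopMotionVelocity P c rate E V) (hc : 0 < c)
    [IsProbabilityMeasure P] {f : ℝ → ℝ} (hf : Continuous f) {K : ℝ} (hK : ∀ x, |f x| ≤ K)
    {u : ℝ} (hu : 0 ≤ u) :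
    ∫ x, f x ∂(P.map (position V u)) =
      cellMean P V f 0 {c} u + cellMean P V f 0 {-c} u + cellMean P V f 0 {0} u := by
  rw [integral_map (hV.measurable_position hc hu).aemeasurable hf.aestronglyMeasurable,
    hV.integral_eq_add_velocity hc (by
      simpa using hV.integrable_comp_position hc hf hK 0 hu) hu]
  simp [cellMean]

theorem ae_stop (hV : IsStopMotionVelocity P c rate E V) [IsProbabilityMeasure P] {s t : ℝ}
    (hs : 0 ≤ s) (hst : s ≤ t) :
    ∀ᵐ ω ∂P, eventCount E s t ω = 1 → V s ω ≠ 0 → V t ω = 0 := by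
  have h := hV.switch_stop s t hs hst
  rw [measureReal_eq_zero_iff] at h
  rw [ae_iff]
  refine measure_mono_null (fun ω hω => ?_) h
  simp only [mem_ofPred_eq, not_forall] at hω ⊢
  obtain ⟨h1, h2, h3⟩ := hω
  have := hV.velocity_mem s hs ω
  tauto

/-- The transitions to `c` and `-c` each take half of the mass of `V s = 0` with a single event, so
none is left for `V t = 0`. -/
theorem ae_start (hV : IsStopMotionVelocity P c rate E V) (hc : 0 < c) [IsProbabilityMeasure P]
    {s t : ℝ} (hs : 0 ≤ s) (hst : s ≤ t) :
    ∀ᵐ ω ∂P, eventCount E s t ω = 1 → V s ω = 0 → V t ω ≠ 0 := by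
  have hp := hV.switch_pos s t hs hst univ MeasurableSet.univ
  have hn := hV.switch_neg s t hs hst univ MeasurableSet.univ
  rw [univ_inter, univ_inter] at hp hn
  have ht := hs.trans hst
  have hms : MeasurableSet {ω | V s ω = 0} :=
    hV.measurable_velocity s hs (measurableSet_singleton 0)
  have hm1 : MeasurableSet {ω | eventCount E s t ω = 1} :=
    hV.poisson.measurable_count s t hs hst 1
  have hmt : ∀ v, MeasurableSet {ω | V s ω = 0 ∧ eventCount E s t ω = 1 ∧ V t ω = v} := fun v =>
    hms.inter (hm1.inter (hV.measurable_velocity t ht (measurableSet_singleton v)))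
  have hsplit : {ω | V s ω = 0 ∧ eventCount E s t ω = 1} =
      ({ω | V s ω = 0 ∧ eventCount E s t ω = 1 ∧ V t ω = c} ∪
        {ω | V s ω = 0 ∧ eventCount E s t ω = 1 ∧ V t ω = -c}) ∪
        {ω | V s ω = 0 ∧ eventCount E s t ω = 1 ∧ V t ω = 0} := by
    ext ω
    have := hV.velocity_mem t ht ω
    simp only [mem_ofPred_eq, mem_union]
    tauto
  have hd1 : Disjoint {ω | V s ω = 0 ∧ eventCount E s t ω = 1 ∧ V t ω = c}
      {ω | V s ω = 0 ∧ eventCount E s t ω = 1 ∧ V t ω = -c} := by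
    rw [disjoint_left]
    rintro ω ⟨-, -, h1⟩ ⟨-, -, h2⟩
    linarith
  have hd2 : Disjoint ({ω | V s ω = 0 ∧ eventCount E s t ω = 1 ∧ V t ω = c} ∪
        {ω | V s ω = 0 ∧ eventCount E s t ω = 1 ∧ V t ω = -c})
        {ω | V s ω = 0 ∧ eventCount E s t ω = 1 ∧ V t ω = 0} := by
    rw [disjoint_left]
    rintro ω (⟨-, -, h1⟩ | ⟨-, -, h1⟩) ⟨-, -, h2⟩ <;> linarith
  have hsum := congrArg P.real hsplit
  rw [measureReal_union hd2 (hmt 0), measureReal_union hd1 (hmt (-c)), hp, hn] at hsum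
  have hzero : P.real {ω | V s ω = 0 ∧ eventCount E s t ω = 1 ∧ V t ω = 0} = 0 := by linarith
  rw [measureReal_eq_zero_iff] at hzero
  rw [ae_iff]
  refine measure_mono_null (fun ω hω => ?_) hzero
  simp only [mem_ofPred_eq, not_forall, not_not] at hω ⊢
  tauto

variable [IsProbabilityMeasure P]

/-- `switch_pos` only concerns paths at rest at time `s`; by `ae_stop` a moving particle almost
surely does not have velocity `c` after a single event. -/
theorem hasInflow_pos (hV : IsStopMotionVelocity P c rate E V) (hc : 0 < c) :
    HasInflow P E V c {0} (1 / 2) where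
  measurableSet := measurableSet_singleton 0
  nonneg := by norm_num
  switch s t hs hst A hA := by
    refine (measureReal_congr ?_).trans (hV.switch_pos s t hs hst A hA)
    filter_upwards [hV.ae_stop hs hst] with ω hω
    refine propext (and_congr_right fun _ => ⟨fun h => ⟨?_, h.2, h.1⟩, fun h => ⟨h.2.2, h.2.1⟩⟩)
    by_contra h0
    exact hc.ne' ((Eq.symm h.1).trans (hω h.2 h0))

theorem hasInflow_neg (hV : IsStopMotionVelocity P c rate E V) (hc : 0 < c) :
    HasInflow P E V (-c) {0} (1 / 2) where
  measurableSet := measurableSet_singleton 0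
  nonneg := by norm_num
  switch s t hs hst A hA := by
    refine (measureReal_congr ?_).trans (hV.switch_neg s t hs hst A hA)
    filter_upwards [hV.ae_stop hs hst] with ω hω
    refine propext (and_congr_right fun _ => ⟨fun h => ⟨?_, h.2, h.1⟩, fun h => ⟨h.2.2, h.2.1⟩⟩)
    by_contra h0
    exact (neg_ne_zero.2 hc.ne') ((Eq.symm h.1).trans (hω h.2 h0))

theorem hasInflow_zero (hV : IsStopMotionVelocity P c rate E V) (hc : 0 < c) :
    HasInflow P E V 0 {c, -c} 1 where
  measurableSet := (measurableSet_singleton _).insert _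
  nonneg := by norm_num
  switch s t hs hst A hA := by
    rw [one_mul]
    refine measureReal_congr ?_
    filter_upwards [hV.ae_stop hs hst, hV.ae_start hc hs hst] with ω h1 h2
    refine propext (and_congr_right fun _ => and_congr_left fun hN => ?_)
    have hmem := hV.velocity_mem s hs ω
    refine ⟨fun h => ?_, fun h => h1 hN ?_⟩
    · rcases hmem with h' | h' | h'
      · exact Or.inl h'
      · exact absurd h (h2 hN h')
      · exact Or.inr h'
    · rcases h with h | h <;> rw [h]
      · exact hc.ne'
      · exact neg_ne_zero.2 hc.ne'

/-- The forward equation is used in the rest frame for the derivatives of `ψ`; the index `k` in `A`,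
`B`, `Z` counts these, and transport raises it by one. Order `3` enters only through continuity,
needed for `C³` regularity in time. -/
theorem isWeakSolution (hV : IsStopMotionVelocity P c rate E V) (hc : 0 < c)
    (hrate : ContDiffOn ℝ 1 rate (Ioi 0)) (hnonneg : ∀ t, 0 < t → 0 ≤ rate t) :
    IsWeakStopPDESolutionOn c rate (fun t => P.map (position V t)) (univ ×ˢ Ioi 0) := by
  intro ψ hψ hψc t ht _
  choose K hK using exists_abs_iteratedDeriv_le hψ hψc
  have hcont := hψ.continuous_iteratedDeriv_of_smooth
  have hder : ∀ {w : ℝ} {D : Set ℝ} {r : ℝ}, HasInflow P E V w D r → ∀ k s, 0 < s →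
      HasDerivAt (cellMean P V (iteratedDeriv k ψ) 0 {w})
        ((w - 0) * cellMean P V (iteratedDeriv (k + 1) ψ) 0 {w} s +
          rate s * (r * cellMean P V (iteratedDeriv k ψ) 0 D s -
            cellMean P V (iteratedDeriv k ψ) 0 {w} s)) s := fun hin k s hs =>
    hV.cellMean_hasDerivAt hc hrate.continuousOn hnonneg hin (hψ.hasDerivAt_iteratedDeriv k)
      (hcont (k + 1)) (K := max (K k) (K (k + 1))) (fun x => (hK k x).trans (le_max_left _ _))
      (fun x => (hK (k + 1) x).trans (le_max_right _ _)) 0 hs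
  refine stopMotion_thirdOrder hrate
    (A := fun k => cellMean P V (iteratedDeriv k ψ) 0 {c})
    (B := fun k => cellMean P V (iteratedDeriv k ψ) 0 {-c})
    (Z := fun k => cellMean P V (iteratedDeriv k ψ) 0 {0})
    (fun k _ s hs => ?_) (fun k _ s hs => ?_) (fun k _ s hs => ?_) ?_ ?_ (fun s hs => ?_)
    (fun s hs => ?_) ht
  · simpa using hder (hV.hasInflow_pos hc) k s hs
  · simpa using hder (hV.hasInflow_neg hc) k s hs
  · simpa [hV.cellMean_pair hc (hcont k) (hK k) 0 hs.le] using
      hder (hV.hasInflow_zero hc) k s hs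
  · exact fun s hs => (hder (hV.hasInflow_pos hc) 3 s hs).continuousAt.continuousWithinAt
  · exact fun s hs => (hder (hV.hasInflow_neg hc) 3 s hs).continuousAt.continuousWithinAt
  · simpa using hV.integral_comp_position hc (hcont 0) (hK 0) hs.le
  · exact hV.integral_comp_position hc (hcont 2) (hK 2) hs.le

end IsStopMotionVelocity

end Law

/-! ### Domination on null sets, tested by smooth functions. -/

theorem exists_contDiff_one_of_isCompact {K U : Set ℝ} (hK : IsCompact K) (hU : IsOpen U)
    (hKU : K ⊆ U) :
    ∃ ψ : ℝ → ℝ, ContDiff ℝ ((⊤ : ℕ∞) : WithTop ℕ∞) ψ ∧ HasCompactSupport ψ ∧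
      (∀ x, ψ x ∈ Icc (0 : ℝ) 1) ∧ (∀ x ∈ K, ψ x = 1) ∧ ∀ x ∉ U, ψ x = 0 := by
  obtain ⟨K', hK', hKK', hK'U⟩ := exists_compact_between hK hU hKU
  obtain ⟨f, h0, h1, hf⟩ := exists_contMDiffMap_zero_one_of_isClosed
    (n := ⊤) (modelWithCornersSelf ℝ ℝ) (s := (interior K')ᶜ) (t := K)
    isOpen_interior.isClosed_compl hK.isClosed (disjoint_compl_left_iff_subset.2 hKK')
  refine ⟨f, f.contMDiff.contDiff, ?_, hf, fun x hx => h1 hx, fun x hx => h0 fun hx' =>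
    hx (hK'U (interior_subset hx'))⟩
  exact HasCompactSupport.intro hK' fun x hx => h0 fun hx' => hx (interior_subset hx')

/-- A measure that is dominated on smooth test functions by `q ν + C dx` is dominated by `q ν`
on Lebesgue null sets. -/
theorem measureReal_le_of_forall_integral_le {μ ν : Measure ℝ} [IsFiniteMeasure μ]
    [IsFiniteMeasure ν] {q C : ℝ} (hq : 0 ≤ q) (hC : 0 ≤ C)
    (h : ∀ ψ : ℝ → ℝ, ContDiff ℝ ((⊤ : ℕ∞) : WithTop ℕ∞) ψ → HasCompactSupport ψ →
      (∀ x, 0 ≤ ψ x) → ∫ x, ψ x ∂μ ≤ q * ∫ x, ψ x ∂ν + C * ∫ x, ψ x)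
    {B : Set ℝ} (hB : MeasurableSet B) (hB0 : volume B = 0) :
    μ.real B ≤ q * ν.real B := by
  refine le_of_forall_pos_le_add fun ε hε => ?_
  -- Three approximations of `B`, each with error `δ`, enter with weights `q` (outer, `ν`), `C`
  -- (outer, Lebesgue) and `1` (inner, `μ`).
  set δ : ℝ := ε / (q + C + 1) with hδ
  have hδ0 : 0 < δ := by positivity
  have hδε : q * δ + C * δ + δ = ε := by rw [hδ]; field_simp
  have hδne : ENNReal.ofReal δ ≠ 0 := by simpa using hδ0
  obtain ⟨U₁, hBU₁, hU₁, hνU₁⟩ := B.exists_isOpen_lt_add (μ := ν) (measure_ne_top _ _) hδne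
  obtain ⟨U₂, hBU₂, hU₂, hvU₂⟩ := B.exists_isOpen_lt_add (μ := volume) (by simp [hB0]) hδne
  obtain ⟨K, hKB, hK, hμK⟩ := hB.exists_isCompact_lt_add (μ := μ) (measure_ne_top _ _) hδne
  obtain ⟨ψ, hψ, hψc, hψI, hψK, hψU⟩ := exists_contDiff_one_of_isCompact hK (hU₁.inter hU₂)
    (hKB.trans (subset_inter hBU₁ hBU₂))
  have hle : ∀ (κ : Measure ℝ) [IsFiniteMeasureOnCompacts κ] (U : Set ℝ), IsOpen U →
      U₁ ∩ U₂ ⊆ U → κ U ≠ ⊤ → ∫ x, ψ x ∂κ ≤ κ.real U := fun κ _ U hU hsub hfin => by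
    rw [← integral_indicator_one hU.measurableSet]
    refine integral_mono (hψ.continuous.integrable_of_hasCompactSupport hψc)
      ((integrable_indicator_iff hU.measurableSet).2 (integrableOn_const hfin)) fun x => ?_
    by_cases hx : x ∈ U
    · simpa [hx] using (hψI x).2
    · simp [hx, hψU x fun hx' => hx (hsub hx')]
  have h1 : μ.real K ≤ ∫ x, ψ x ∂μ := by
    rw [← integral_indicator_one hK.measurableSet]
    refine integral_mono ((integrable_indicator_iff hK.measurableSet).2
      (integrableOn_const (measure_ne_top _ _)))
      (hψ.continuous.integrable_of_hasCompactSupport hψc) fun x => ?_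
    by_cases hx : x ∈ K
    · simp [hx, hψK x hx]
    · simpa [hx] using (hψI x).1
  have h2 : ∫ x, ψ x ∂ν ≤ ν.real B + δ := by
    refine (hle ν U₁ hU₁ inter_subset_left (measure_ne_top _ _)).trans ?_
    rw [measureReal_def, measureReal_def, ← ENNReal.toReal_ofReal hδ0.le,
      ← ENNReal.toReal_add (measure_ne_top _ _) ENNReal.ofReal_ne_top]
    exact ENNReal.toReal_mono (by finiteness) hνU₁.le
  have h3 : ∫ x, ψ x ≤ δ := by
    rw [hB0, zero_add] at hvU₂
    refine (hle volume U₂ hU₂ inter_subset_right (hvU₂.trans ENNReal.ofReal_lt_top).ne).trans ?_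
    exact ENNReal.toReal_le_of_le_ofReal hδ0.le hvU₂.le
  have h4 : μ.real B ≤ μ.real K + δ := by
    rw [measureReal_def, measureReal_def, ← ENNReal.toReal_ofReal hδ0.le,
      ← ENNReal.toReal_add (measure_ne_top _ _) ENNReal.ofReal_ne_top]
    exact ENNReal.toReal_mono (by finiteness) hμK.le
  have h5 := h ψ hψ hψc fun x => (hψI x).1
  have h6 := mul_le_mul_of_nonneg_left h2 hq
  have h7 := mul_le_mul_of_nonneg_left h3 hC
  linarith

/-! ### Estimates in moving frames. -/

section AbsoluteContinuity

theorem cellMean_nonneg {Ω : Type*} [MeasurableSpace Ω] {P : Measure Ω} {V : ℝ → Ω → ℝ} {f : ℝ → ℝ} (hf : ∀ x, 0 ≤ f x)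
    (a : ℝ) (D : Set ℝ) (u : ℝ) :
    0 ≤ cellMean P V f a D u :=
  integral_nonneg fun _ => hf _

variable {Ω : Type*} [MeasurableSpace Ω] {P : Measure Ω} {c : ℝ}
  {rate : ℝ → ℝ} {E : Ω → Set ℝ} {V : ℝ → Ω → ℝ} {w : ℝ} {D : Set ℝ} {r : ℝ}
  [IsProbabilityMeasure P]

namespace IsStopMotionVelocity

theorem intervalIntegrable_cellMean (hV : IsStopMotionVelocity P c rate E V) (hc : 0 < c)
    (hrate : ContinuousOn rate (Ioi 0)) {f : ℝ → ℝ} (hf : Continuous f) {K : ℝ}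
    (hK : ∀ x, |f x| ≤ K) (a : ℝ) (hD : MeasurableSet D) {s t : ℝ} (hs : 0 < s) (ht : 0 < t) :
    IntervalIntegrable (cellMean P V f a D) volume s t :=
  ContinuousOn.intervalIntegrable fun _ hu =>
    (hV.continuousAt_cellMean hc hrate hf hK a hD
      ((lt_min hs ht).trans_le hu.1)).continuousWithinAt

/-- Time integrals of a mean, seen from a frame moving with velocity `a ≠ w`, are bounded by the
space integral of the test function. -/
theorem abs_integral_cellMean_le (hV : IsStopMotionVelocity P c rate E V) (hc : 0 < c)
    (hrate : ContinuousOn rate (Ioi 0)) (hnonneg : ∀ t, 0 < t → 0 ≤ rate t)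
    (hin : HasInflow P E V w D r) (hr : r ≤ 1) {F f : ℝ → ℝ} (hF : ∀ x, HasDerivAt F (f x) x)
    (hf : Continuous f) {K I : ℝ} (hK : ∀ x, |f x| ≤ K) (hI : ∀ x, |F x| ≤ I) (a : ℝ)
    {s t L : ℝ} (hs : 0 < s) (hst : s ≤ t) (hL : ∀ u ∈ Icc s t, rate u ≤ L) :
    |w - a| * |∫ u in s..t, cellMean P V f a {w} u| ≤ (2 + 2 * L * (t - s)) * I := by
  have ht := hs.trans_le hst
  have hFc : Continuous F := continuous_iff_continuousAt.2 fun x => (hF x).continuousAt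
  have hI0 : 0 ≤ I := (abs_nonneg _).trans (hI 0)
  have hmw := measurableSet_singleton w
  have hint1 := (hV.intervalIntegrable_cellMean hc hrate hf hK a hmw hs ht).const_mul (w - a)
  have hpos : ∀ u ∈ uIcc s t, 0 < u := fun u hu => (lt_min hs ht).trans_le hu.1
  have hint2 : IntervalIntegrable (fun u => rate u *
      (r * cellMean P V F a D u - cellMean P V F a {w} u)) volume s t :=
    ContinuousOn.intervalIntegrable <| (hrate.mono hpos).mul <| ContinuousOn.sub
      (ContinuousOn.mul continuousOn_const fun u hu => (hV.continuousAt_cellMean hc hrate hFc hI a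
        hin.measurableSet (hpos u hu)).continuousWithinAt)
      fun u hu => (hV.continuousAt_cellMean hc hrate hFc hI a hmw
        (hpos u hu)).continuousWithinAt
  -- The forward equation is integrated for the primitive `F`: its transport term is the wanted
  -- integral of `f`, and the boundary and jump terms are controlled by the sup bound `I` of `F`.
  have hftc := intervalIntegral.integral_eq_sub_of_hasDerivAt (f := cellMean P V F a {w})
    (fun u hu => hV.cellMean_hasDerivAt hc hrate hnonneg hin hF hf
      (K := max I K) (fun x => (hI x).trans (le_max_left _ _))
      (fun x => (hK x).trans (le_max_right _ _)) a (hpos u hu)) (hint1.add hint2)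
  rw [intervalIntegral.integral_add hint1 hint2, intervalIntegral.integral_const_mul] at hftc
  have hb : |∫ u in s..t, rate u * (r * cellMean P V F a D u - cellMean P V F a {w} u)| ≤
      2 * L * I * |t - s| := by
    rw [← Real.norm_eq_abs]
    refine intervalIntegral.norm_integral_le_of_norm_le_const fun u hu => ?_
    rw [uIoc_of_le hst] at hu
    have hr0 := hnonneg u (hs.trans hu.1)
    have hrL := hL u ⟨hu.1.le, hu.2⟩
    rw [Real.norm_eq_abs, abs_mul, abs_of_nonneg hr0]
    have h1 : |r * cellMean P V F a D u| ≤ I := by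
      rw [abs_mul, abs_of_nonneg hin.nonneg]
      exact (mul_le_of_le_one_left (abs_nonneg _) hr).trans (abs_cellMean_le hI a D u)
    have h2 : |r * cellMean P V F a D u - cellMean P V F a {w} u| ≤ 2 * I :=
      (abs_sub _ _).trans (by linarith [abs_cellMean_le (P := P) (V := V) hI a {w} u])
    calc _ ≤ L * (2 * I) := mul_le_mul hrL h2 (abs_nonneg _) (hr0.trans hrL)
      _ = _ := by ring
  rw [abs_of_nonneg (sub_nonneg.2 hst)] at hb
  have h1 := abs_cellMean_le (P := P) (V := V) hI a {w} t
  have h2 := abs_cellMean_le (P := P) (V := V) hI a {w} s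
  rw [← abs_mul, eq_sub_of_add_eq hftc]
  have h3 := abs_sub (cellMean P V F a {w} t - cellMean P V F a {w} s)
    (∫ u in s..t, rate u * (r * cellMean P V F a D u - cellMean P V F a {w} u))
  have h4 := abs_sub (cellMean P V F a {w} t) (cellMean P V F a {w} s)
  linarith

/-- In the frame moving with velocity `w` the mean restricted to velocity `w` only changes by
damping and by inflow. -/
theorem cellMean_comoving_le (hV : IsStopMotionVelocity P c rate E V) (hc : 0 < c)
    (hrate : ContinuousOn rate (Ioi 0)) (hnonneg : ∀ t, 0 < t → 0 ≤ rate t)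
    (hin : HasInflow P E V w D r) {f f' : ℝ → ℝ} (hf : ∀ x, HasDerivAt f (f' x) x)
    (hf' : Continuous f') {K : ℝ} (hK : ∀ x, |f x| ≤ K) (hK' : ∀ x, |f' x| ≤ K)
    (hf0 : ∀ x, 0 ≤ f x) {s t L : ℝ} (hs : 0 < s) (hst : s ≤ t)
    (hL : ∀ u ∈ Icc s t, rate u ≤ L) :
    cellMean P V f w {w} t ≤ Real.exp (-∫ u in s..t, rate u) * cellMean P V f w {w} s +
      L * r * ∫ u in s..t, cellMean P V f w D u := by
  have ht := hs.trans_le hst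
  have hfc : Continuous f := continuous_iff_continuousAt.2 fun x => (hf x).continuousAt
  set Λ : ℝ → ℝ := fun u => ∫ x in s..u, rate x with hΛ
  have hpos : ∀ u ∈ uIcc s t, 0 < u := fun u hu => (lt_min hs ht).trans_le hu.1
  have hdΛ : ∀ u, 0 < u → HasDerivAt Λ (rate u) u := fun u hu =>
    intervalIntegral.integral_hasDerivAt_right (intervalIntegrable_rate hrate hs hu)
      (hrate.stronglyMeasurableAtFilter isOpen_Ioi u hu) (hrate.continuousAt (Ioi_mem_nhds hu))
  -- With frame velocity `w` the transport term is zero, and the integrating factor `exp Λ` absorbs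
  -- the damping.
  have hd : ∀ u ∈ uIcc s t, HasDerivAt (fun u => Real.exp (Λ u) * cellMean P V f w {w} u)
      (Real.exp (Λ u) * (rate u * (r * cellMean P V f w D u))) u := fun u hu =>
    ((hdΛ u (hpos u hu)).exp.mul (hV.cellMean_hasDerivAt hc hrate hnonneg hin hf hf' hK hK' w
      (hpos u hu))).congr_deriv (by ring)
  have hD : ContinuousOn (cellMean P V f w D) (uIcc s t) := fun u hu =>
    (hV.continuousAt_cellMean hc hrate hfc hK w hin.measurableSet (hpos u hu)).continuousWithinAt
  have hΛc : ContinuousOn Λ (uIcc s t) := fun u hu =>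
    (hdΛ u (hpos u hu)).continuousAt.continuousWithinAt
  have hint : IntervalIntegrable
      (fun u => Real.exp (Λ u) * (rate u * (r * cellMean P V f w D u))) volume s t :=
    ContinuousOn.intervalIntegrable <| hΛc.rexp.mul
      ((hrate.mono hpos).mul (continuousOn_const.mul hD))
  have hftc := intervalIntegral.integral_eq_sub_of_hasDerivAt hd hint
  have hle : ∫ u in s..t, Real.exp (Λ u) * (rate u * (r * cellMean P V f w D u)) ≤
      ∫ u in s..t, Real.exp (Λ t) * (L * r) * cellMean P V f w D u := by
    refine intervalIntegral.integral_mono_on hst hint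
      ((hD.intervalIntegrable).const_mul _) fun u hu => ?_
    have hu0 := hs.trans_le hu.1
    have hΛle : Λ u ≤ Λ t := by
      rw [hΛ, ← sub_nonneg, intervalIntegral.integral_interval_sub_left
        (intervalIntegrable_rate hrate hs ht) (intervalIntegrable_rate hrate hs hu0)]
      exact integral_rate_nonneg hnonneg hu0 hu.2
    have hm0 : 0 ≤ r * cellMean P V f w D u := mul_nonneg hin.nonneg (cellMean_nonneg hf0 w D u)
    calc _ ≤ Real.exp (Λ t) * (L * (r * cellMean P V f w D u)) :=
          mul_le_mul (Real.exp_le_exp.2 hΛle) (mul_le_mul_of_nonneg_right (hL u hu) hm0)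
            (mul_nonneg (hnonneg u hu0) hm0) (Real.exp_pos _).le
      _ = _ := by ring
  rw [hftc, intervalIntegral.integral_const_mul] at hle
  have hΛs : Λ s = 0 := intervalIntegral.integral_same
  rw [hΛs, Real.exp_zero, one_mul] at hle
  have h := mul_le_mul_of_nonneg_left hle (Real.exp_pos (-Λ t)).le
  have he : Real.exp (-Λ t) * Real.exp (Λ t) = 1 := by rw [← Real.exp_add]; simp
  have e1 : Real.exp (-Λ t) * (Real.exp (Λ t) * cellMean P V f w {w} t - cellMean P V f w {w} s) =
      cellMean P V f w {w} t - Real.exp (-Λ t) * cellMean P V f w {w} s := by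
    rw [mul_sub, ← mul_assoc, he, one_mul]
  have e2 : Real.exp (-Λ t) * (Real.exp (Λ t) * (L * r) * ∫ u in s..t, cellMean P V f w D u) =
      L * r * ∫ u in s..t, cellMean P V f w D u := by
    rw [← mul_assoc, ← mul_assoc, he, one_mul]
  rw [e1, e2] at h
  linarith

end IsStopMotionVelocity

end AbsoluteContinuity

/-! ### Singular part of the law, atoms and existence of the density. -/

section Atoms

variable {Ω : Type*} [MeasurableSpace Ω] {P : Measure Ω} {c : ℝ}
  {rate : ℝ → ℝ} {E : Ω → Set ℝ} {V : ℝ → Ω → ℝ} [IsProbabilityMeasure P]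

namespace IsStopMotionVelocity

/-- `cellMean_comoving_le` is applied at each of the three velocities. The undisturbed parts add up
to free flight from time `s`, and every inflow comes from a velocity at distance exactly `c`, so
`abs_integral_cellMean_le` bounds it by the Lebesgue integral of `ψ`. -/
theorem integral_test_le (hV : IsStopMotionVelocity P c rate E V) (hc : 0 < c)
    (hrate : ContinuousOn rate (Ioi 0)) (hnonneg : ∀ t, 0 < t → 0 ≤ rate t)
    {ψ : ℝ → ℝ} (hψ : ContDiff ℝ ((⊤ : ℕ∞) : WithTop ℕ∞) ψ) (hψc : HasCompactSupport ψ)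
    (hψ0 : ∀ x, 0 ≤ ψ x) {s t L : ℝ} (hs : 0 < s) (hst : s ≤ t)
    (hL : ∀ u ∈ Icc s t, rate u ≤ L) :
    ∫ x, ψ x ∂(P.map (position V t)) ≤
      Real.exp (-∫ u in s..t, rate u) *
          ∫ x, ψ x ∂(P.map fun ω => position V s ω + (t - s) * V s ω) +
        3 * L * ((2 + 2 * L * (t - s)) / c) * ∫ x, ψ x := by
  have ht := hs.trans_le hst
  have hL0 : 0 ≤ L := (hnonneg s hs).trans (hL s (left_mem_Icc.2 hst))
  obtain ⟨K₀, hK₀⟩ := exists_abs_iteratedDeriv_le hψ hψc 0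
  obtain ⟨K₁, hK₁⟩ := exists_abs_iteratedDeriv_le hψ hψc 1
  rw [iteratedDeriv_zero] at hK₀
  rw [iteratedDeriv_one] at hK₁
  set K := max K₀ K₁
  have hK : ∀ x, |ψ x| ≤ K := fun x => (hK₀ x).trans (le_max_left _ _)
  have hK' : ∀ x, |deriv ψ x| ≤ K := fun x => (hK₁ x).trans (le_max_right _ _)
  have hd : ∀ x, HasDerivAt ψ (deriv ψ x) x := fun x =>
    (hψ.differentiable (by simp) x).hasDerivAt
  have hd' : Continuous (deriv ψ) := hψ.continuous_deriv (by simp)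
  set I := ∫ x, ψ x with hI
  have hint : Integrable ψ := hψ.continuous.integrable_of_hasCompactSupport hψc
  set Ψ : ℝ → ℝ := fun x => ∫ y in (0 : ℝ)..x, ψ y with hΨ
  have hdΨ : ∀ x, HasDerivAt Ψ (ψ x) x := fun x =>
    intervalIntegral.integral_hasDerivAt_right (hψ.continuous.intervalIntegrable _ _)
      hψ.continuous.stronglyMeasurable.stronglyMeasurableAtFilter hψ.continuous.continuousAt
  have hΨI : ∀ x, |Ψ x| ≤ I := fun x => by
    rw [← Real.norm_eq_abs]
    refine (intervalIntegral.norm_integral_le_integral_norm_uIoc (μ := volume)).trans ?_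
    simp only [Real.norm_eq_abs, abs_of_nonneg (hψ0 _)]
    exact setIntegral_le_integral hint (.of_forall hψ0)
  -- The shift makes `φ w` in the frame of velocity `w` equal to `ψ` of the position at time `t`,
  -- and to `ψ` of the free-flight position when evaluated at time `s` on `V s = w`.
  set φ : ℝ → ℝ → ℝ := fun w x => ψ (x + w * t) with hφ
  set C := (2 + 2 * L * (t - s)) * I with hC
  have hφc : ∀ w, Continuous (φ w) := fun w => hψ.continuous.comp (by fun_prop)
  have htime : ∀ {v : ℝ} {D : Set ℝ} {r : ℝ}, HasInflow P E V v D r → r ≤ 1 → ∀ w, |v - w| = c →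
      ∫ u in s..t, cellMean P V (φ w) w {v} u ≤ C / c := fun {v D r} hin hr w hvw => by
    have h := hV.abs_integral_cellMean_le hc hrate hnonneg hin hr
      (F := fun x => Ψ (x + w * t)) (f := φ w) (fun x => (hdΨ _).comp_add_const x (w * t))
      (hφc w) (fun x => hK _) (fun x => hΨI _) w hs hst hL
    rw [hvw] at h
    rw [le_div_iff₀ hc, mul_comm]
    exact (mul_le_mul_of_nonneg_left (le_abs_self _) hc.le).trans h
  have hcomove : ∀ {w : ℝ} {D : Set ℝ} {r : ℝ}, HasInflow P E V w D r →
      cellMean P V ψ 0 {w} t ≤ Real.exp (-∫ u in s..t, rate u) *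
        ∫ ω in V s ⁻¹' {w}, ψ (position V s ω + (t - s) * V s ω) ∂P +
          L * r * ∫ u in s..t, cellMean P V (φ w) w D u := fun {w D r} hin => by
    have h := hV.cellMean_comoving_le hc hrate hnonneg hin (f := φ w)
      (f' := fun x => deriv ψ (x + w * t)) (fun x => (hd _).comp_add_const x (w * t))
      (hd'.comp (by fun_prop)) (fun x => hK _) (fun x => hK' _) (fun x => hψ0 _) hs hst hL
    have e1 : cellMean P V (φ w) w {w} t = cellMean P V ψ 0 {w} t := by simp [cellMean, hφ]
    have e2 : cellMean P V (φ w) w {w} s =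
        ∫ ω in V s ⁻¹' {w}, ψ (position V s ω + (t - s) * V s ω) ∂P := by
      refine setIntegral_congr_fun (hV.measurable_velocity s hs.le (measurableSet_singleton w))
        fun ω hω => ?_
      have hω' : V s ω = w := hω
      simp only [hφ, hω']
      congr 1
      ring
    rwa [e1, e2] at h
  have hpos := hcomove (hV.hasInflow_pos hc)
  have hneg := hcomove (hV.hasInflow_neg hc)
  have hzero := hcomove (hV.hasInflow_zero hc)
  have hpair : ∫ u in s..t, cellMean P V (φ 0) 0 {c, -c} u =
      (∫ u in s..t, cellMean P V (φ 0) 0 {c} u) + ∫ u in s..t, cellMean P V (φ 0) 0 {-c} u := by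
    rw [← intervalIntegral.integral_add
      (hV.intervalIntegrable_cellMean hc hrate (hφc 0) (fun x => hK _) 0
        (measurableSet_singleton _) hs ht)
      (hV.intervalIntegrable_cellMean hc hrate (hφc 0) (fun x => hK _) 0
        (measurableSet_singleton _) hs ht)]
    refine intervalIntegral.integral_congr fun u hu => ?_
    exact hV.cellMean_pair hc (hφc 0) (fun x => hK _) 0 ((lt_min hs ht).trans_le hu.1).le
  have b1 := htime (hV.hasInflow_zero hc) le_rfl c (by simp [abs_of_pos hc])
  have b2 := htime (hV.hasInflow_zero hc) le_rfl (-c) (by simp [abs_of_pos hc])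
  have b3 := htime (hV.hasInflow_pos hc) (by norm_num) 0 (by simp [abs_of_pos hc])
  have b4 := htime (hV.hasInflow_neg hc) (by norm_num) 0 (by simp [abs_of_pos hc])
  have hm : Measurable fun ω => position V s ω + (t - s) * V s ω :=
    (hV.measurable_position hc hs.le).add ((hV.measurable_velocity s hs.le).const_mul _)
  have hintν : Integrable (fun ω => ψ (position V s ω + (t - s) * V s ω)) P :=
    .of_bound (hψ.continuous.measurable.comp hm).aestronglyMeasurable K (.of_forall fun _ => hK _)
  rw [hV.integral_comp_position hc hψ.continuous hK ht.le,
    integral_map hm.aemeasurable hψ.continuous.aestronglyMeasurable,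
    hV.integral_eq_add_velocity hc hintν hs.le]
  -- The factor `3` is the total inflow weight: `1/2` into each of `c` and `-c`, and `1` into `0`
  -- from each of `c` and `-c`.
  have hCdiv : 3 * L * ((2 + 2 * L * (t - s)) / c) * I = 3 * (L * (C / c)) := by
    rw [hC]; ring
  rw [hCdiv]
  have m1 := mul_le_mul_of_nonneg_left b1 hL0
  have m2 := mul_le_mul_of_nonneg_left b2 hL0
  have m3 := mul_le_mul_of_nonneg_left b3 hL0
  have m4 := mul_le_mul_of_nonneg_left b4 hL0
  rw [hpair, mul_one, mul_add] at hzero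
  rw [mul_right_comm] at hpos hneg
  linarith

/-- The Lebesgue term of `integral_test_le` disappears on a null set. Thus any local bound `L` of
the rate will do, and one exists because `[s, t]` is compact in `(0, ∞)`. -/
theorem measureReal_position_mem_le (hV : IsStopMotionVelocity P c rate E V) (hc : 0 < c)
    (hrate : ContinuousOn rate (Ioi 0)) (hnonneg : ∀ t, 0 < t → 0 ≤ rate t)
    {B : Set ℝ} (hB : MeasurableSet B) (hB0 : volume B = 0) {s t : ℝ} (hs : 0 < s)
    (hst : s ≤ t) :
    P.real (position V t ⁻¹' B) ≤ Real.exp (-∫ u in s..t, rate u) *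
      P.real ((fun ω => position V s ω + (t - s) * V s ω) ⁻¹' B) := by
  have hm : Measurable fun ω => position V s ω + (t - s) * V s ω :=
    (hV.measurable_position hc hs.le).add ((hV.measurable_velocity s hs.le).const_mul _)
  have hmt := hV.measurable_position hc (hs.trans_le hst).le
  obtain ⟨L, hL⟩ := (isCompact_Icc (a := s) (b := t)).bddAbove_image
    (hrate.mono fun u hu => hs.trans_le hu.1)
  have hL' : ∀ u ∈ Icc s t, rate u ≤ L := fun u hu => hL (mem_image_of_mem _ hu)
  have hL0 : 0 ≤ L := (hnonneg s hs).trans (hL' s (left_mem_Icc.2 hst))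
  have := Measure.isProbabilityMeasure_map (μ := P) hm.aemeasurable
  have := Measure.isProbabilityMeasure_map (μ := P) hmt.aemeasurable
  have hts := sub_nonneg.2 hst
  rw [← map_measureReal_apply hm hB, ← map_measureReal_apply hmt hB]
  exact measureReal_le_of_forall_integral_le (Real.exp_pos _).le
    (C := 3 * L * ((2 + 2 * L * (t - s)) / c)) (by positivity)
    (fun ψ hψ hψc hψ0 => hV.integral_test_le hc hrate hnonneg hψ hψc hψ0 hs hst hL') hB hB0

/-- A positive probability `q` would give `q ≤ exp (-∫ rate)` over `(s, t]`, hence `∫ rate ≤ -log q`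
uniformly in `s > 0`; a nonnegative rate would then be integrable down to `0`. -/
theorem measure_position_mem_eq_zero_of_not_integrableOn (hV : IsStopMotionVelocity P c rate E V)
    (hc : 0 < c) (hrate : ContinuousOn rate (Ioi 0)) (hnonneg : ∀ t, 0 < t → 0 ≤ rate t)
    {B : Set ℝ} (hB : MeasurableSet B) (hB0 : volume B = 0) {t : ℝ} (ht : 0 < t)
    (hnot : ¬ IntegrableOn rate (Ioc 0 t)) : P (position V t ⁻¹' B) = 0 := by
  by_contra hne
  have hpos : 0 < P.real (position V t ⁻¹' B) :=
    (measureReal_nonneg).lt_of_ne fun h => hne ((measureReal_eq_zero_iff).1 h.symm)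
  refine hnot (integrableOn_Ioc_of_intervalIntegral_norm_bounded_left
    (I := -Real.log (P.real (position V t ⁻¹' B)))
    (l := atTop) (a := fun n : ℕ => t * (1 / ((n : ℝ) + 1))) (fun n => ?_) ?_
    (.of_forall fun n => ?_))
  · exact (intervalIntegrable_rate hrate (by positivity) ht).1
  · simpa using tendsto_one_div_add_atTop_nhds_zero_nat.const_mul t
  · have hs : 0 < t * (1 / ((n : ℝ) + 1)) := by positivity
    have hst : t * (1 / ((n : ℝ) + 1)) ≤ t := by
      refine mul_le_of_le_one_right ht.le ?_
      rw [div_le_one (by positivity)]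
      linarith [Nat.cast_nonneg (α := ℝ) n]
    have h := (hV.measureReal_position_mem_le hc hrate hnonneg hB hB0 hs hst).trans
      (mul_le_of_le_one_right (Real.exp_pos _).le measureReal_le_one)
    rw [← Real.log_le_iff_le_exp hpos, intervalIntegral.integral_of_le hst] at h
    rw [setIntegral_congr_fun (g := rate) measurableSet_Ioc fun u hu =>
      Real.norm_of_nonneg (hnonneg u (hs.trans hu.1))]
    linarith

/-- Let `s → 0` in `measureReal_position_mem_le`. Without an event in `(0, s]` the free-flight
position is `t * V 0`, and the probability of an event there tends to `0`. -/
theorem measureReal_position_mem_le_of_integrableOn (hV : IsStopMotionVelocity P c rate E V)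
    (hc : 0 < c) (hrate : ContinuousOn rate (Ioi 0)) (hnonneg : ∀ t, 0 < t → 0 ≤ rate t)
    {B : Set ℝ} (hB : MeasurableSet B) (hB0 : volume B = 0) {t : ℝ} (ht : 0 < t)
    (hint : IntegrableOn rate (Ioc 0 t)) :
    P.real (position V t ⁻¹' B) ≤ Real.exp (-∫ u in Ioc 0 t, rate u) *
      P.real ((fun ω => t * V 0 ω) ⁻¹' B) := by
  set F : ℝ → ℝ := fun s => ∫ u in Ioc 0 s, rate u with hF
  have hFc : ContinuousOn F (Icc 0 t) := intervalIntegral.continuousOn_primitive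
    (integrableOn_Icc_iff_integrableOn_Ioc (by simp) |>.2 hint)
  have hF0 : Tendsto F (𝓝[>] 0) (𝓝 0) := by
    have h := (hFc 0 (left_mem_Icc.2 ht.le)).tendsto
    have hF00 : F 0 = 0 := by simp [hF]
    rw [hF00] at h
    refine h.mono_left ?_
    rw [← nhdsWithin_Ioc_eq_nhdsGT ht]
    exact nhdsWithin_mono _ Ioc_subset_Icc_self
  have hlim : Tendsto (fun s => Real.exp (-(F t - F s)) *
      (P.real ((fun ω => t * V 0 ω) ⁻¹' B) + (1 - Real.exp (-F s)))) (𝓝[>] 0)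
      (𝓝 (Real.exp (-(F t - 0)) *
        (P.real ((fun ω => t * V 0 ω) ⁻¹' B) + (1 - Real.exp (-0))))) :=
    ((Real.continuous_exp.tendsto _).comp (hF0.const_sub (F t)).neg).mul
      ((((Real.continuous_exp.tendsto _).comp hF0.neg).const_sub 1).const_add _)
  have hsimp : Real.exp (-(F t - 0)) *
      (P.real ((fun ω => t * V 0 ω) ⁻¹' B) + (1 - Real.exp (-0))) =
      Real.exp (-∫ u in Ioc 0 t, rate u) * P.real ((fun ω => t * V 0 ω) ⁻¹' B) := by
    simp [hF]
  rw [hsimp] at hlim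
  refine ge_of_tendsto hlim ?_
  filter_upwards [Ioc_mem_nhdsGT ht] with s hs
  have hints : IntegrableOn rate (Ioc 0 s) := hint.mono_set (Ioc_subset_Ioc_right hs.2)
  have hΛ : ∫ u in s..t, rate u = F t - F s := by
    have h := intervalIntegral.integral_interval_sub_left (μ := volume) (f := rate)
      ((intervalIntegrable_iff_integrableOn_Ioc_of_le ht.le).2 hint)
      ((intervalIntegrable_iff_integrableOn_Ioc_of_le hs.1.le).2 hints)
    rw [← h, intervalIntegral.integral_of_le ht.le, intervalIntegral.integral_of_le hs.1.le]
  rw [← hΛ]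
  refine (hV.measureReal_position_mem_le hc hrate hnonneg hB hB0 hs.1 hs.2).trans
    (mul_le_mul_of_nonneg_left ?_ (Real.exp_pos _).le)
  have hN : P.real {ω | eventCount E 0 s ω ≠ 0} = 1 - Real.exp (-F s) := by
    have h : {ω | eventCount E 0 s ω ≠ 0} = {ω | eventCount E 0 s ω = 0}ᶜ := rfl
    have h0 := hV.poisson.poisson_law 0 s le_rfl hs.1.le hints 0
    rw [h, probReal_compl_eq_one_sub (hV.poisson.measurable_count 0 s le_rfl hs.1.le 0)]
    simp only [Nat.cast_zero, pow_zero, mul_one, Nat.factorial_zero, Nat.cast_one, div_one] at h0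
    rw [h0]
  rw [← hN]
  refine (measureReal_mono fun ω hω => ?_).trans (measureReal_union_le _ _)
  by_cases h0 : eventCount E 0 s ω = 0
  · left
    have h1 := hV.position_eq_of_eventCount_eq_zero hc le_rfl hs.1.le h0
    have h2 := hV.const_between 0 s le_rfl hs.1.le ω h0
    have h3 : position V 0 ω = 0 := by simp [position]
    have h4 : position V s ω + (t - s) * V s ω = t * V 0 ω := by
      rw [h1, h2, h3]
      ring
    rw [mem_preimage, ← h4]
    exact hω
  · exact Or.inr h0

/-- The upper bound is the previous estimate for a single point. For the lower bound, initial
velocity `v` and no event in `(0, t]` are independent and force the position `v * t`. -/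
theorem measureReal_position_eq_of_integrableOn (hV : IsStopMotionVelocity P c rate E V)
    (hc : 0 < c) (hrate : ContinuousOn rate (Ioi 0)) (hnonneg : ∀ t, 0 < t → 0 ≤ rate t)
    (v : ℝ) {t : ℝ} (ht : 0 < t) (hint : IntegrableOn rate (Ioc 0 t)) :
    P.real {ω | position V t ω = v * t} =
      Real.exp (-∫ u in Ioc 0 t, rate u) * P.real {ω | V 0 ω = v} := by
  refine le_antisymm ?_ ?_
  · have h := hV.measureReal_position_mem_le_of_integrableOn hc hrate hnonneg
      (measurableSet_singleton (v * t)) (by simp) ht hint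
    have hset : (fun ω => t * V 0 ω) ⁻¹' {v * t} = {ω | V 0 ω = v} := by
      ext ω
      simp only [mem_preimage, mem_singleton_iff, mem_ofPred_eq]
      rw [mul_comm, mul_left_inj' ht.ne']
    rwa [hset] at h
  · have h := hV.measureReal_inter_eventCount le_rfl ht.le (A := {ω | V 0 ω = v})
      (measurable_velocity_history le_rfl le_rfl (measurableSet_singleton v)) 0
    have h0 := hV.poisson.poisson_law 0 t le_rfl ht.le hint 0
    simp only [Nat.cast_zero, pow_zero, mul_one, Nat.factorial_zero, Nat.cast_one, div_one] at h0
    rw [h0] at h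
    rw [← h]
    refine measureReal_mono ?_
    rintro ω ⟨h1, h2⟩
    have h1' : V 0 ω = v := h1
    have h3 := hV.position_eq_of_eventCount_eq_zero hc le_rfl ht.le h2
    rw [mem_ofPred_eq, h3, h1']
    simp [position, mul_comm]

theorem measure_position_mem_eq_zero (hV : IsStopMotionVelocity P c rate E V)
    (hc : 0 < c) (hrate : ContinuousOn rate (Ioi 0)) (hnonneg : ∀ t, 0 < t → 0 ≤ rate t)
    {t : ℝ} (ht : 0 < t) {B : Set ℝ} (hB : MeasurableSet B) (hB0 : volume B = 0)
    (hBdisj : Disjoint B {0, c * t, -(c * t)}) : P (position V t ⁻¹' B) = 0 := by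
  by_cases hint : IntegrableOn rate (Ioc 0 t)
  · have h := hV.measureReal_position_mem_le_of_integrableOn hc hrate hnonneg hB hB0 ht hint
    have hset : (fun ω => t * V 0 ω) ⁻¹' B = ∅ := by
      refine eq_empty_iff_forall_notMem.2 fun ω hω => disjoint_left.1 hBdisj hω ?_
      rcases hV.velocity_mem 0 le_rfl ω with h | h | h <;> simp [h, mul_comm]
    rw [hset, measureReal_empty, mul_zero] at h
    exact (measureReal_eq_zero_iff).1 (le_antisymm h measureReal_nonneg)
  · exact hV.measure_position_mem_eq_zero_of_not_integrableOn hc hrate hnonneg hB hB0 ht hint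

/-- Off the three possible atoms the law is absolutely continuous, and its Radon–Nikodym derivative
is the density. The three points are distinct because `c * t > 0`, so the rest is a sum of three
Dirac masses. -/
theorem exists_isTransitionDensity (hV : IsStopMotionVelocity P c rate E V)
    (hc : 0 < c) (hrate : ContinuousOn rate (Ioi 0)) (hnonneg : ∀ t, 0 < t → 0 ≤ rate t) :
    ∃ p : ℝ → ℝ → ℝ, IsTransitionDensity P c (position V) p := by
  set S : ℝ → Set ℝ := fun t => {0, c * t, -(c * t)} with hS
  have hSm : ∀ t, MeasurableSet (S t) := fun t => by
    simp only [hS]; measurability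
  set ρ : ℝ → Measure ℝ := fun t => (P.map (position V t)).restrict (S t)ᶜ with hρ
  refine ⟨fun x t => ((ρ t).rnDeriv volume x).toReal, fun t ht => ?_, fun x t ht => ?_,
    fun t ht => ?_⟩
  · exact (Measure.measurable_rnDeriv _ _).ennreal_toReal
  · exact ENNReal.toReal_nonneg
  · have hm := hV.measurable_position hc ht.le
    have hac : ρ t ≪ volume := by
      refine Measure.AbsolutelyContinuous.mk fun B hB hB0 => ?_
      rw [hρ, Measure.restrict_apply hB, Measure.map_apply hm (hB.inter (hSm t).compl)]
      exact hV.measure_position_mem_eq_zero hc hrate hnonneg ht (hB.inter (hSm t).compl)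
        (measure_mono_null inter_subset_left hB0) (disjoint_compl_left.mono_left inter_subset_right)
    have hwd : volume.withDensity
        (fun x => ENNReal.ofReal ((ρ t).rnDeriv volume x).toReal) = ρ t := by
      conv_rhs => rw [← Measure.withDensity_rnDeriv_eq _ _ hac]
      refine withDensity_congr_ae ?_
      filter_upwards [(ρ t).rnDeriv_ne_top volume] with x hx using ENNReal.ofReal_toReal hx
    rw [hwd]
    have hct : 0 < c * t := mul_pos hc ht
    have hpoint : ∀ y, P {ω | position V t ω = y} = P.map (position V t) {y} := fun y => by
      rw [Measure.map_apply hm (measurableSet_singleton y)]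
      rfl
    have hrestrict : (P.map (position V t)).restrict (S t) =
        P {ω | position V t ω = 0} • Measure.dirac (0 : ℝ)
          + (P {ω | position V t ω = c * t} • Measure.dirac (c * t)
          + P {ω | position V t ω = -(c * t)} • Measure.dirac (-(c * t))) := by
      rw [hpoint, hpoint, hpoint, ← Measure.restrict_singleton, ← Measure.restrict_singleton,
        ← Measure.restrict_singleton, ← Measure.restrict_union _ (measurableSet_singleton _),
        ← Measure.restrict_union]
      · rfl
      · rw [disjoint_singleton_left]
        rintro (h | h) <;> linarith [mem_singleton_iff.1 h]
      · exact (measurableSet_singleton _).union (measurableSet_singleton _)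
      · rw [disjoint_singleton]
        linarith
    rw [← Measure.restrict_compl_add_restrict (μ := P.map (position V t)) (hSm t), hrestrict, ← add_assoc, ← add_assoc]

end IsStopMotionVelocity

end Atoms

/-! ### Partial derivatives on open sets and integration by parts. -/

noncomputable section PartialDerivatives

/-- The partial derivative of a function on the plane with respect to the first variable. -/
def partialFst (G : ℝ × ℝ → ℝ) (z : ℝ × ℝ) : ℝ := deriv (fun y => G (y, z.2)) z.1

/-- The partial derivative of a function on the plane with respect to the second variable. -/
def partialSnd (G : ℝ × ℝ → ℝ) (z : ℝ × ℝ) : ℝ := deriv (fun s => G (z.1, s)) z.2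

variable {G : ℝ × ℝ → ℝ} {W : Set (ℝ × ℝ)} {n : ℕ}

theorem ContDiffOn.hasFDerivAt_of_isOpen (hG : ContDiffOn ℝ (n + 1 : ℕ) G W) (hW : IsOpen W)
    {z : ℝ × ℝ} (hz : z ∈ W) : HasFDerivAt G (fderiv ℝ G z) z :=
  ((hG.differentiableOn (by simp)).differentiableAt (hW.mem_nhds hz)).hasFDerivAt

theorem hasDerivAt_slice_fst (hG : ContDiffOn ℝ (n + 1 : ℕ) G W) (hW : IsOpen W)
    {z : ℝ × ℝ} (hz : z ∈ W) : HasDerivAt (fun y => G (y, z.2)) (fderiv ℝ G z (1, 0)) z.1 :=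
  (hG.hasFDerivAt_of_isOpen hW hz).comp_hasDerivAt (f := fun y => (y, z.2)) z.1
    ((hasDerivAt_id z.1).prodMk (hasDerivAt_const z.1 z.2))

theorem hasDerivAt_slice_snd (hG : ContDiffOn ℝ (n + 1 : ℕ) G W) (hW : IsOpen W)
    {z : ℝ × ℝ} (hz : z ∈ W) : HasDerivAt (fun s => G (z.1, s)) (fderiv ℝ G z (0, 1)) z.2 :=
  (hG.hasFDerivAt_of_isOpen hW hz).comp_hasDerivAt (f := fun s => (z.1, s)) z.2
    ((hasDerivAt_const z.2 z.1).prodMk (hasDerivAt_id z.2))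

theorem hasDerivAt_partialFst (hG : ContDiffOn ℝ (n + 1 : ℕ) G W) (hW : IsOpen W)
    {x t : ℝ} (hz : (x, t) ∈ W) : HasDerivAt (fun y => G (y, t)) (partialFst G (x, t)) x :=
  (hasDerivAt_slice_fst hG hW hz).differentiableAt.hasDerivAt

theorem hasDerivAt_partialSnd (hG : ContDiffOn ℝ (n + 1 : ℕ) G W) (hW : IsOpen W)
    {x t : ℝ} (hz : (x, t) ∈ W) : HasDerivAt (fun s => G (x, s)) (partialSnd G (x, t)) t :=
  (hasDerivAt_slice_snd hG hW hz).differentiableAt.hasDerivAt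

theorem contDiffOn_partialFst (hG : ContDiffOn ℝ (n + 1 : ℕ) G W) (hW : IsOpen W) :
    ContDiffOn ℝ n (partialFst G) W :=
  ((hG.fderiv_of_isOpen hW (m := n) (by norm_cast)).clm_apply contDiffOn_const).congr
    fun _ hz => (hasDerivAt_slice_fst hG hW hz).deriv

theorem contDiffOn_partialSnd (hG : ContDiffOn ℝ (n + 1 : ℕ) G W) (hW : IsOpen W) :
    ContDiffOn ℝ n (partialSnd G) W :=
  ((hG.fderiv_of_isOpen hW (m := n) (by norm_cast)).clm_apply contDiffOn_const).congr
    fun _ hz => (hasDerivAt_slice_snd hG hW hz).deriv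

/-- The tube lemma: a compact slice inside `W` stays inside `W` for nearby times, which is what time
derivatives at `t` require. -/
theorem exists_prod_Icc_subset (hW : IsOpen W) {K : Set ℝ} (hK : IsCompact K) {t : ℝ}
    (h : ∀ x ∈ K, (x, t) ∈ W) :
    ∃ ε > 0, ∀ x ∈ K, ∀ s ∈ Icc (t - ε) (t + ε), (x, s) ∈ W := by
  obtain ⟨u, v, -, hv, hKu, htv, huv⟩ := generalized_tube_lemma hK (isCompact_singleton (x := t)) hW
    (by rintro ⟨x, s⟩ ⟨hx, rfl : s = t⟩; exact h x hx)
  obtain ⟨ε, hε, hball⟩ := Metric.nhds_basis_closedBall.mem_iff.1 (hv.mem_nhds (htv rfl))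
  rw [Real.closedBall_eq_Icc] at hball
  exact ⟨ε, hε, fun x hx s hs => huv ⟨hKu hx, hball hs⟩⟩

theorem hasDerivAt_setIntegral_mul (hG : ContDiffOn ℝ (n + 1 : ℕ) G W) (hW : IsOpen W)
    {ψ : ℝ → ℝ} (hψ : Continuous ψ) {K : Set ℝ} (hK : IsCompact K) {t : ℝ}
    (h : ∀ x ∈ K, (x, t) ∈ W) :
    HasDerivAt (fun s => ∫ x in K, ψ x * G (x, s)) (∫ x in K, ψ x * partialSnd G (x, t)) t := by
  obtain ⟨ε, hε, hbox⟩ := exists_prod_Icc_subset hW hK h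
  have hnhds : Icc (t - ε) (t + ε) ∈ 𝓝 t := Icc_mem_nhds (by linarith) (by linarith)
  have hcont : ∀ {H : ℝ × ℝ → ℝ}, ContinuousOn H W → ∀ s ∈ Icc (t - ε) (t + ε),
      ContinuousOn (fun x => ψ x * H (x, s)) K := fun {H} hH s hs =>
    hψ.continuousOn.mul (hH.comp (by fun_prop) fun x hx => hbox x hx s hs)
  have hP := (contDiffOn_partialSnd hG hW).continuousOn
  obtain ⟨M, hM⟩ := (hK.prod (isCompact_Icc (a := t - ε) (b := t + ε))).exists_bound_of_continuousOn
    (f := partialSnd G) (hP.mono fun z hz => hbox z.1 hz.1 z.2 hz.2)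
  have htmem := mem_of_mem_nhds hnhds
  refine (hasDerivAt_integral_of_dominated_loc_of_deriv_le (μ := volume.restrict K)
    (F := fun s x => ψ x * G (x, s)) (F' := fun s x => ψ x * partialSnd G (x, s))
    (bound := fun x => |ψ x| * M) hnhds ?_ ?_ ?_ ?_ ?_ ?_).2
  · filter_upwards [hnhds] with s hs
    exact (hcont hG.continuousOn s hs).aestronglyMeasurable_of_isCompact hK hK.measurableSet
  · exact (hcont hG.continuousOn t htmem).integrableOn_compact hK
  · exact (hcont hP t htmem).aestronglyMeasurable_of_isCompact hK hK.measurableSet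
  · filter_upwards [ae_restrict_mem hK.measurableSet] with x hx s hs
    rw [norm_mul]
    exact mul_le_mul_of_nonneg_left (hM (x, s) ⟨hx, hs⟩) (norm_nonneg _)
  · exact (hψ.abs.mul continuous_const).continuousOn.integrableOn_compact hK
  · filter_upwards [ae_restrict_mem hK.measurableSet] with x hx s hs
    exact (hasDerivAt_partialSnd hG hW (hbox x hx s hs)).const_mul _

/-- Two integrations by parts; the endpoints lie outside `tsupport ψ`, where both `ψ` and its
derivative vanish. -/
theorem integral_iteratedDeriv_two_mul {ψ : ℝ → ℝ} (hψ : ContDiff ℝ ((⊤ : ℕ∞) : WithTop ℕ∞) ψ)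
    {α β : ℝ} (hαβ : α ≤ β) (hψα : α ∉ tsupport ψ) (hψβ : β ∉ tsupport ψ) {g g' g'' : ℝ → ℝ}
    (hg : ∀ x ∈ Icc α β, HasDerivAt g (g' x) x) (hg' : ∀ x ∈ Icc α β, HasDerivAt g' (g'' x) x)
    (hg'' : ContinuousOn g'' (Icc α β)) :
    ∫ x in Icc α β, iteratedDeriv 2 ψ x * g x = ∫ x in Icc α β, ψ x * g'' x := by
  simp only [integral_Icc_eq_integral_Ioc, ← intervalIntegral.integral_of_le hαβ]
  have hψ0 : ∀ x ∉ tsupport ψ, ψ x = 0 := fun x hx => image_eq_zero_of_notMem_tsupport hx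
  have hψ1 : ∀ x ∉ tsupport ψ, deriv ψ x = 0 := fun x hx => by
    by_contra h
    exact hx (support_deriv_subset h)
  have hd0 : ∀ x, HasDerivAt ψ (deriv ψ x) x := fun x => by
    simpa using hψ.hasDerivAt_iteratedDeriv 0 x
  have hd1 : ∀ x, HasDerivAt (deriv ψ) (iteratedDeriv 2 ψ x) x := fun x => by
    simpa only [iteratedDeriv_one] using hψ.hasDerivAt_iteratedDeriv 1 x
  have hc2 := hψ.continuous_iteratedDeriv_of_smooth 2
  have hc1 : Continuous (deriv ψ) := continuous_iff_continuousAt.2 fun x => (hd1 x).continuousAt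
  rw [← uIcc_of_le hαβ] at hg hg' hg''
  have hg'c : ContinuousOn g' (uIcc α β) := fun x hx => (hg' x hx).continuousAt.continuousWithinAt
  have e1 := intervalIntegral.integral_mul_deriv_eq_deriv_mul (a := α) (b := β)
    (u := g) (v := deriv ψ) (u' := g') (v' := iteratedDeriv 2 ψ) hg (fun x _ => hd1 x)
    hg'c.intervalIntegrable (hc2.intervalIntegrable _ _)
  have e2 := intervalIntegral.integral_mul_deriv_eq_deriv_mul (a := α) (b := β)
    (u := g') (v := ψ) (u' := g'') (v' := deriv ψ) hg' (fun x _ => hd0 x)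
    hg''.intervalIntegrable (hc1.intervalIntegrable _ _)
  rw [hψ1 α hψα, hψ1 β hψβ] at e1
  rw [hψ0 α hψα, hψ0 β hψβ] at e2
  simp only [mul_comm _ (g _), mul_comm _ (g'' _)]
  rw [e1, e2]
  ring

end PartialDerivatives

/-! ### From the law to its density, and from the weak to the pointwise equation. -/

section Density

variable {Ω : Type*} [MeasurableSpace Ω] {P : Measure Ω} {c : ℝ}
  {rate : ℝ → ℝ} {E : Ω → Set ℝ} {V : ℝ → Ω → ℝ} [IsProbabilityMeasure P]

theorem tsupport_iteratedDeriv_two_subset (ψ : ℝ → ℝ) :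
    tsupport (iteratedDeriv 2 ψ) ⊆ tsupport ψ := by
  have h : ∀ f : ℝ → ℝ, tsupport (deriv f) ⊆ tsupport f := fun f =>
    closure_minimal support_deriv_subset (isClosed_tsupport f)
  rw [iteratedDeriv_succ, iteratedDeriv_one]
  exact (h _).trans (h _)

/-- Each Dirac term drops out: its mass is zero if the point lies in `tsupport g`, and `g` vanishes
there otherwise. -/
theorem IsTransitionDensity.integral_eq {X : ℝ → Ω → ℝ} {p : ℝ → ℝ → ℝ}
    (hp : IsTransitionDensity P c X p) {t : ℝ} (ht : 0 < t) (hX : AEMeasurable (X t) P)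
    {g : ℝ → ℝ} (hg : Continuous g) (hgc : HasCompactSupport g)
    (hatom : ∀ x ∈ tsupport g, P {ω | X t ω = x} = 0) :
    ∫ x, g x ∂(volume.withDensity fun x => ENNReal.ofReal (p x t)) = ∫ x, g x ∂(P.map (X t)) := by
  have := Measure.isProbabilityMeasure_map hX
  have hint : Integrable g (P.map (X t)) := hg.integrable_of_hasCompactSupport hgc
  have hterm : ∀ y, ∫ x, g x ∂(P {ω | X t ω = y} • Measure.dirac y) = 0 := fun y => by
    rw [integral_smul_measure, integral_dirac]
    by_cases hy : y ∈ tsupport g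
    · simp [hatom y hy]
    · simp [image_eq_zero_of_notMem_tsupport hy]
  have hlaw := hp.law_eq t ht
  rw [hlaw] at hint ⊢
  have h1 := hint.left_of_add_measure
  have h2 := h1.left_of_add_measure
  have h3 := h2.left_of_add_measure
  rw [integral_add_measure h1 hint.right_of_add_measure,
    integral_add_measure h2 h1.right_of_add_measure,
    integral_add_measure h3 h2.right_of_add_measure, hterm, hterm, hterm]
  simp

/-- The integrals against density and law agree for all times near `t`, not only at `t`, so the time
derivatives agree too. -/
theorem isWeakSolution_density {X : ℝ → Ω → ℝ} (hX : ∀ t, 0 < t → AEMeasurable (X t) P)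
    (hweak : IsWeakStopPDESolutionOn c rate (fun t => P.map (X t)) (univ ×ˢ Ioi 0))
    {p : ℝ → ℝ → ℝ} (hp : IsTransitionDensity P c X p) {W : Set (ℝ × ℝ)} (hW : IsOpen W)
    (hatom : ∀ z ∈ W, 0 < z.2 ∧ P {ω | X z.2 ω = z.1} = 0) :
    IsWeakStopPDESolutionOn c rate
      (fun t => volume.withDensity (fun x => ENNReal.ofReal (p x t))) W := by
  intro ψ hψ hψc t ht hsupp
  obtain ⟨hC, heq⟩ := hweak ψ hψ hψc t ht fun x _ => ⟨trivial, ht⟩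
  obtain ⟨ε, hε, hbox⟩ := exists_prod_Icc_subset hW hψc.isCompact hsupp
  have hev : ∀ {g : ℝ → ℝ}, Continuous g → HasCompactSupport g → tsupport g ⊆ tsupport ψ →
      (fun s => ∫ x, g x ∂(volume.withDensity fun x => ENNReal.ofReal (p x s))) =ᶠ[𝓝 t]
        fun s => ∫ x, g x ∂(P.map (X s)) := fun {g} hg hgc hsub => by
    filter_upwards [Ioi_mem_nhds ht,
      Icc_mem_nhds (show t - ε < t by linarith) (show t < t + ε by linarith)] with s hs0 hs
    exact hp.integral_eq hs0 (hX s hs0) hg hgc fun x hx => (hatom _ (hbox x (hsub hx) s hs)).2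
  have e0 := hev hψ.continuous hψc subset_rfl
  have e2 := hev (hψ.continuous_iteratedDeriv_of_smooth 2) (hψc.iteratedDeriv_real 2)
    (tsupport_iteratedDeriv_two_subset ψ)
  refine ⟨hC.congr_of_eventuallyEq e0, ?_⟩
  rw [e0.iteratedDeriv_eq, e0.iteratedDeriv_eq, e0.deriv_eq, e2.deriv_eq, e2.eq_of_nhds]
  exact heq

/-- The defect `h` of the equation on the slice `t = t₀` is continuous near `x₀` and integrates to
zero against every test function supported there, so it vanishes. -/
theorem satisfiesStopPDEAt_of_weak {p : ℝ → ℝ → ℝ} {W : Set (ℝ × ℝ)}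
    (hpm : ∀ t : ℝ, 0 < t → Measurable fun x => p x t) (hp0 : ∀ x t : ℝ, 0 < t → 0 ≤ p x t)
    (hW : IsOpen W) (hW0 : ∀ z ∈ W, 0 < z.2)
    (hweak : IsWeakStopPDESolutionOn c rate
      (fun t => volume.withDensity (fun x => ENNReal.ofReal (p x t))) W)
    (hreg : ContDiffOn ℝ 3 (fun z : ℝ × ℝ => p z.1 z.2) W) {x₀ t₀ : ℝ} (hz : (x₀, t₀) ∈ W) :
    SatisfiesStopPDEAt c rate p x₀ t₀ := by
  have ht₀ : 0 < t₀ := hW0 _ hz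
  set Q : ℝ × ℝ → ℝ := fun z => p z.1 z.2 with hQ
  have hQ3 : ContDiffOn ℝ (2 + 1 : ℕ) Q W := hreg
  have hT1 : ContDiffOn ℝ (1 + 1 : ℕ) (partialSnd Q) W := contDiffOn_partialSnd hQ3 hW
  have hT2 : ContDiffOn ℝ (0 + 1 : ℕ) (partialSnd (partialSnd Q)) W := contDiffOn_partialSnd hT1 hW
  have hT3 := (contDiffOn_partialSnd hT2 hW).continuousOn
  have hX1 : ContDiffOn ℝ (1 + 1 : ℕ) (partialFst Q) W := contDiffOn_partialFst hQ3 hW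
  have hX2 : ContDiffOn ℝ (0 + 1 : ℕ) (partialFst (partialFst Q)) W := contDiffOn_partialFst hX1 hW
  have hXT := (contDiffOn_partialSnd hX2 hW).continuousOn
  set R := partialFst (partialFst Q) with hR
  obtain ⟨δ, hδ, hslice⟩ : ∃ δ > 0, ∀ x ∈ Icc (x₀ - δ) (x₀ + δ), (x, t₀) ∈ W := by
    have hopen : (fun x => (x, t₀)) ⁻¹' W ∈ 𝓝 x₀ :=
      (hW.preimage (by fun_prop)).mem_nhds hz
    obtain ⟨δ, hδ, hball⟩ := Metric.nhds_basis_closedBall.mem_iff.1 hopen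
    rw [Real.closedBall_eq_Icc] at hball
    exact ⟨δ, hδ, fun x hx => hball hx⟩
  set α := x₀ - δ
  set β := x₀ + δ
  have hαβ : α < β := by simp only [α, β]; linarith
  have hK : IsCompact (Icc α β) := isCompact_Icc
  obtain ⟨ε, hε, hbox⟩ := exists_prod_Icc_subset hW hK hslice
  set J := Ioo (t₀ - ε) (t₀ + ε)
  have htJ : t₀ ∈ J := ⟨by linarith, by linarith⟩
  have hboxJ : ∀ s ∈ J, ∀ x ∈ Icc α β, (x, s) ∈ W := fun s hs x hx =>
    hbox x hx s (Ioo_subset_Icc_self hs)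
  have hJ0 : ∀ s ∈ J, 0 < s := fun s hs => hW0 _ (hboxJ s hs α (left_mem_Icc.2 hαβ.le))
  set h : ℝ → ℝ := fun x =>
    partialSnd (partialSnd (partialSnd Q)) (x, t₀) +
      3 * rate t₀ * partialSnd (partialSnd Q) (x, t₀) +
      (2 * rate t₀ ^ 2 + deriv rate t₀) * partialSnd Q (x, t₀) -
      (c ^ 2 * partialSnd R (x, t₀) + c ^ 2 * rate t₀ * R (x, t₀)) with hh
  have hsl : ∀ {H : ℝ × ℝ → ℝ}, ContinuousOn H W → ContinuousOn (fun x => H (x, t₀)) (Icc α β) :=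
    fun hH => hH.comp (by fun_prop) fun x hx => hslice x hx
  have c1 := hsl hT1.continuousOn
  have c2 := hsl hT2.continuousOn
  have c3 := hsl hT3
  have c4 := hsl hX2.continuousOn
  have c5 := hsl hXT
  have hhc : ContinuousOn h (Icc α β) :=
    ((c3.add (continuousOn_const.mul c2)).add (continuousOn_const.mul c1)).sub
      ((continuousOn_const.mul c5).add (continuousOn_const.mul c4))
  have htest : ∀ ψ : ℝ → ℝ, ContDiff ℝ ((⊤ : ℕ∞) : WithTop ℕ∞) ψ → HasCompactSupport ψ →
      tsupport ψ ⊆ Ioo α β → ∫ x, ψ x • h x = 0 := fun ψ hψ hψc hsupp => by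
    -- Outside the interval `p` is merely measurable in `x`, but `g` vanishes there; the integral is
    -- reduced to a region where `Q` is `C³`.
    have hdens : ∀ {g : ℝ → ℝ}, tsupport g ⊆ tsupport ψ → ∀ s ∈ J,
        ∫ x, g x ∂(volume.withDensity fun x => ENNReal.ofReal (p x s)) =
          ∫ x in Icc α β, g x * Q (x, s) := fun {g} hsub s hs => by
      rw [integral_withDensity_eq_integral_toReal_smul (hpm s (hJ0 s hs)).ennreal_ofReal
        (.of_forall fun _ => ENNReal.ofReal_lt_top),
        setIntegral_eq_integral_of_forall_compl_eq_zero fun x hx => ?_]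
      · refine integral_congr_ae (.of_forall fun x => ?_)
        simp only [ENNReal.toReal_ofReal (hp0 x s (hJ0 s hs)), smul_eq_mul, hQ]
        ring
      · have hx' : x ∉ tsupport g := fun hx' =>
          hx (Ioo_subset_Icc_self (hsupp (hsub hx')))
        simp [image_eq_zero_of_notMem_tsupport hx']
    obtain ⟨-, heq⟩ := hweak ψ hψ hψc t₀ ht₀ fun x hx =>
      hslice x (Ioo_subset_Icc_self (hsupp hx))
    have hd1 : ∀ s ∈ J, HasDerivAt
        (fun s => ∫ x, ψ x ∂(volume.withDensity fun x => ENNReal.ofReal (p x s)))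
        (∫ x in Icc α β, ψ x * partialSnd Q (x, s)) s := fun s hs =>
      (hasDerivAt_setIntegral_mul hQ3 hW hψ.continuous hK (hboxJ s hs)).congr_of_eventuallyEq
        (by filter_upwards [isOpen_Ioo.mem_nhds hs] with r hr using hdens subset_rfl r hr)
    obtain ⟨i1, i2, i3⟩ := iteratedDeriv_eq_of_hasDerivAt isOpen_Ioo hd1
      (fun s hs => hasDerivAt_setIntegral_mul hT1 hW hψ.continuous hK (hboxJ s hs))
      (fun s hs => hasDerivAt_setIntegral_mul hT2 hW hψ.continuous hK (hboxJ s hs)) htJ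
    have hxx : ∀ s ∈ J, ∫ x, iteratedDeriv 2 ψ x
        ∂(volume.withDensity fun x => ENNReal.ofReal (p x s)) =
        ∫ x in Icc α β, ψ x * R (x, s) := fun s hs => by
      rw [hdens (tsupport_iteratedDeriv_two_subset ψ) s hs]
      exact integral_iteratedDeriv_two_mul hψ hαβ.le (fun hx => lt_irrefl _ (hsupp hx).1)
        (fun hx => lt_irrefl _ (hsupp hx).2)
        (fun x hx => hasDerivAt_partialFst hQ3 hW (hboxJ s hs x hx))
        (fun x hx => hasDerivAt_partialFst hX1 hW (hboxJ s hs x hx))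
        (hX2.continuousOn.comp (by fun_prop) fun x hx => hboxJ s hs x hx)
    have hdxx : deriv (fun s => ∫ x, iteratedDeriv 2 ψ x
        ∂(volume.withDensity fun x => ENNReal.ofReal (p x s))) t₀ =
        ∫ x in Icc α β, ψ x * partialSnd R (x, t₀) :=
      ((hasDerivAt_setIntegral_mul hX2 hW hψ.continuous hK
        (hboxJ t₀ htJ)).congr_of_eventuallyEq
          (by filter_upwards [isOpen_Ioo.mem_nhds htJ] with r hr using hxx r hr)).deriv
    rw [i1, i2, i3, hdxx, hxx t₀ htJ] at heq
    have hI : ∀ {g : ℝ → ℝ}, ContinuousOn g (Icc α β) →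
        IntegrableOn (fun x => ψ x * g x) (Icc α β) := fun hg =>
      (hψ.continuous.continuousOn.mul hg).integrableOn_compact hK
    rw [← setIntegral_eq_integral_of_forall_compl_eq_zero (s := Icc α β) fun x hx => by
      rw [image_eq_zero_of_notMem_tsupport fun hx' => hx (Ioo_subset_Icc_self (hsupp hx')),
        zero_smul]]
    have hexp : ∀ x, ψ x • h x =
        (ψ x * partialSnd (partialSnd (partialSnd Q)) (x, t₀) +
          3 * rate t₀ * (ψ x * partialSnd (partialSnd Q) (x, t₀)) +
          (2 * rate t₀ ^ 2 + deriv rate t₀) * (ψ x * partialSnd Q (x, t₀))) -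
        (c ^ 2 * (ψ x * partialSnd R (x, t₀)) + c ^ 2 * rate t₀ * (ψ x * R (x, t₀))) := fun x => by
      simp only [hh, smul_eq_mul]
      ring
    simp only [hexp]
    have j1 := (hI c1).const_mul (2 * rate t₀ ^ 2 + deriv rate t₀)
    have j2 := (hI c2).const_mul (3 * rate t₀)
    have j3 := hI c3
    have j4 := (hI c4).const_mul (c ^ 2 * rate t₀)
    have j5 := (hI c5).const_mul (c ^ 2)
    rw [integral_sub (by exact (j3.add j2).add j1) (by exact j5.add j4),
      integral_add (by exact j3.add j2) j1, integral_add j3 j2, integral_add j5 j4]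
    simp only [integral_const_mul]
    linarith
  have hae := isOpen_Ioo.ae_eq_zero_of_integral_contDiff_smul_eq_zero
    ((hhc.mono Ioo_subset_Icc_self).locallyIntegrableOn measurableSet_Ioo) htest
  have hzero : EqOn h (fun _ => 0) (Ioo α β) :=
    Measure.eqOn_open_of_ae_eq ((ae_restrict_iff' measurableSet_Ioo).2 hae) isOpen_Ioo
      (hhc.mono Ioo_subset_Icc_self) continuousOn_const
  have hfinal : h x₀ = 0 := hzero ⟨by simp only [α]; linarith, by simp only [β]; linarith⟩
  -- The iterated derivatives unfold to the nested partial derivatives in `h`, with the time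
  -- derivative taken last in the mixed term.
  simp only [SatisfiesStopPDEAt, iteratedDeriv_succ, iteratedDeriv_zero]
  exact sub_eq_zero.1 hfinal

end Density

/-! ### Assembly; the atoms are the cases `v = c`, `-c`, `0` with their initial probabilities. -/

theorem mainTheorem4 {Ω : Type*} [MeasurableSpace Ω] (P : Measure Ω) [IsProbabilityMeasure P]
    (c : ℝ) (hc : 0 < c)
    (rate : ℝ → ℝ) (hrate : ContDiffOn ℝ 1 rate (Ioi 0)) (hrate_nonneg : ∀ t, 0 < t → 0 ≤ rate t)
    (E : Ω → Set ℝ) (V : ℝ → Ω → ℝ) (hV : IsStopMotionVelocity P c rate E V) :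
    -- the position is a random variable with a density, apart from the possible atoms
    (∀ t : ℝ, 0 < t → AEMeasurable (position V t) P) ∧
    (∃ p : ℝ → ℝ → ℝ, IsTransitionDensity P c (position V) p) ∧
    -- the law of the position satisfies the equation on the whole of `ℝ × (0, ∞)`
    IsWeakStopPDESolutionOn c rate (fun t => P.map (position V t)) (univ ×ˢ Ioi 0) ∧
    -- the density satisfies the equation wherever there is no atom, weakly in general
    -- and pointwise where it is of class `C³`
    (∀ p : ℝ → ℝ → ℝ, IsTransitionDensity P c (position V) p →
      ∀ W : Set (ℝ × ℝ), IsOpen W →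
        (∀ z ∈ W, 0 < z.2 ∧ P {ω | position V z.2 ω = z.1} = 0) →
        IsWeakStopPDESolutionOn c rate
            (fun t => volume.withDensity (fun x => ENNReal.ofReal (p x t))) W ∧
        (ContDiffOn ℝ 3 (fun z : ℝ × ℝ => p z.1 z.2) W →
          ∀ z ∈ W, SatisfiesStopPDEAt c rate p z.1 z.2)) ∧
    -- the atoms
    (∀ t : ℝ, 0 < t → IntegrableOn rate (Ioc 0 t) →
      P.real {ω | position V t ω = c * t} = Real.exp (-∫ s in Ioc 0 t, rate s) / 4 ∧
      P.real {ω | position V t ω = -(c * t)} = Real.exp (-∫ s in Ioc 0 t, rate s) / 4 ∧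
      1 / 2 * P.real {ω | position V t ω = 0} = Real.exp (-∫ s in Ioc 0 t, rate s) / 4) ∧
    (∀ t : ℝ, 0 < t → ¬ IntegrableOn rate (Ioc 0 t) →
      ∀ x : ℝ, P {ω | position V t ω = x} = 0) := by
  have hcont := hrate.continuousOn
  have hmeas : ∀ t : ℝ, 0 < t → AEMeasurable (position V t) P := fun t ht =>
    (hV.measurable_position hc ht.le).aemeasurable
  have hweak := hV.isWeakSolution hc hrate hrate_nonneg
  refine ⟨hmeas, hV.exists_isTransitionDensity hc hcont hrate_nonneg, hweak,
    fun p hp W hW hatom => ?_, fun t ht hint => ?_, fun t ht hnot x => ?_⟩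
  · have hweakp := isWeakSolution_density hmeas hweak hp hW hatom
    exact ⟨hweakp, fun hreg z hz => satisfiesStopPDEAt_of_weak hp.measurable hp.nonneg hW
      (fun z hz => (hatom z hz).1) hweakp hreg hz⟩
  · have h := fun v => hV.measureReal_position_eq_of_integrableOn hc hcont hrate_nonneg v ht hint
    have hpos := h c
    have hneg := h (-c)
    have hzero := h 0
    rw [hV.init_pos] at hpos
    rw [hV.init_neg, neg_mul] at hneg
    rw [hV.init_zero, zero_mul] at hzero
    rw [hpos, hneg, hzero]
    refine ⟨by ring, by ring, by ring⟩
  · exact hV.measure_position_mem_eq_zero_of_not_integrableOn hc hcont hrate_nonneg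
      (measurableSet_singleton x) (by simp) ht hnot
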